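/- Let $n\ge 1$ and $\lambda=(\lambda_1,\dots,\lambda_n)\in(-1/2,\infty)^n$, and let $d\mu_\lambda(x)=\prod_{j=1}^n x_j^{2\lambda_j}\,dx_j$ on $(0,\infty)^n$. For $s,u,v>0$ and $\ell>-1/2$ let $$W_s^{\ell}(u,v)=\frac{(uv)^{-\ell+1/2}}{2s}\,I_{\ell-1/2}\!\left(\frac{uv}{2s}\right)e^{-(u^2+v^2)/4s}$$ be the Bessel heat kernel, where $I_\nu(z)=\sum_{k=0}^\infty \frac{(z/2)^{2k+\nu}}{k!\,\Gamma(k+\nu+1)}$ is the modified Bessel function of the first kind. Let $r=(r_1,\dots,r_n)$, where each $r_j:[0,\infty)\to[0,\infty)$ is continuous and nondecreasing with $r_j(0)=0$, $r_j(t)>0$ for $t>0$, and $\lim_{t\to+\infty}r_j(t)=+\infty$. Let $1\le p<\infty$ and let $f\in L^p((0,\infty)^n,d\mu_\lambda)$ be real- or complex-valued. Then for every $x\in(0,\infty)^n$ and $t>0$ the integral $$\mathbb{W}_{r(t)}^\lambda(f)(x)=\int_{(0,\infty)^n}\ \prod_{j=1}^n W_{r_j(t)}^{\lambda_j}(x_j,y_j)\,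 f(y)\,d\mu_\lambda(y)$$ converges absolutely, and $$\lim_{t\to0^+}\mathbb{W}_{r(t)}^\lambda(f)(x)=f(x)\qquad\text{for almost every }x\in(0,\infty)^n.$$ -/

import Mathlib

open MeasureTheory Filter Topology
open scoped NNReal ENNReal

noncomputable section

namespace BesselHeat

/-- The modified Bessel function of the first kind `I_ν(z)` for `z > 0`, by its power series
`∑ₖ (z/2)^(2k+ν) / (k! Γ(k+ν+1))`. -/
def besselI (ν z : ℝ) : ℝ :=
  ∑' k : ℕ, (z / 2) ^ (2 * (k : ℝ) + ν) / ((k.factorial : ℝ) * Real.Gamma ((k : ℝ) + ν + 1))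

/-- The one-dimensional Bessel heat kernel `W_t^lam(x, y)`, for `t, x, y > 0`. -/
def heatKernel (lam t x y : ℝ) : ℝ :=
  (x * y) ^ (-lam + 1 / 2) / (2 * t) * besselI (lam - 1 / 2) (x * y / (2 * t)) *
    Real.exp (-(x ^ 2 + y ^ 2) / (4 * t))

/-- The measure `x^(2 lam) dx` on `(0, ∞)`. -/
def weight (lam : ℝ) : Measure ℝ :=
  (volume.restrict (Set.Ioi 0)).withDensity (fun x => ENNReal.ofReal (x ^ (2 * lam)))

/-- The measure `dμ_lam(x) = ∏ⱼ xⱼ^(2 lamⱼ) dxⱼ` on `(0, ∞)^n`, seen as a measure on `ℝ^n` that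
gives no mass to the complement of `(0, ∞)^n`. -/
def mu {n : ℕ} (lam : Fin n → ℝ) : Measure (Fin n → ℝ) :=
  Measure.pi (fun j => weight (lam j))

/-- The `n`-dimensional kernel `∏ⱼ W_{sⱼ}^{lamⱼ}(xⱼ, yⱼ)`, with one time `sⱼ` per coordinate. -/
def multiKernel {n : ℕ} (lam s x y : Fin n → ℝ) : ℝ :=
  ∏ j, heatKernel (lam j) (s j) (x j) (y j)

/-- The operator `f ↦ ∫ (∏ⱼ W_{sⱼ}^{lamⱼ}(xⱼ, yⱼ)) f(y) dμ_lam(y)`. -/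
def heatOp {n : ℕ} {𝕜 : Type*} [RCLike 𝕜] (lam s : Fin n → ℝ) (f : (Fin n → ℝ) → 𝕜)
    (x : Fin n → ℝ) : 𝕜 :=
  ∫ y, multiKernel lam s x y • f y ∂(mu lam)

end BesselHeat

end

/-!
The kernel `multiKernel lam s x` is, for fixed `x` and `s`, a probability density with respect to
`mu lam` (`lintegral_multiKernel`): in one variable, integrating the Bessel series term by term gives
Gamma integrals and leaves an exponential series. Hence Jensen's inequality, applied in the `L^p`
space of that probability measure, reduces everything to two facts: the convergence at every point
for continuous compactly supported functions (`tendsto_eLpNorm_sub_heatMeasure`), and a weak type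
`(1, 1)` estimate for the maximal operator `sup_{0 < t ≤ 1}` along the curve `r`
(`exists_mul_mu_setOf_lt_lintegral_multiKernel_le`), applied to `|f - g| ^ p`, where `g` is
continuous with compact support and close to `f` in `L^p`.

Both facts come from a pointwise domination of the kernel. The bound
`I_ν(z) ≲ z ^ ν (1 + z) ^ (-ν - 1/2) e ^ z` (`exists_summable_besselSeries_le`) gives, in one
variable, rapid decay in `|x - y| / √s` with the correct normalization by the measure of the interval
of radius `√s` (`exists_heatKernel_le`). In several variables the kernel is then at most
`∑ₖ A 4⁻ᵏ 1_{Bₖ} / μ(Bₖ)`, where `Bₖ` is the box with centre `x` and half side lengths `(k + 1) √sⱼ`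
(`exists_multiKernel_le_tsum`).

For a fixed `k`, the boxes attached to the times `r t` increase with `t` in all coordinates at once,
since each `r j` is monotone. This is what makes the weak type `(1, 1)` estimate true for them,
although it fails for averages over arbitrary boxes when `n ≥ 2`: such a one-parameter family
satisfies the Vitali covering lemma, and `mu lam` is doubling
(`mul_mu_setOf_lt_lintegral_box_le`). The constant does not
depend on `k`, so the estimates can be added up over `k`.
-/

namespace BesselHeat

/-! ### Growth of ratios of Gamma values -/

theorem Gamma_add_nat_add_one {s : ℝ} (hs : 0 < s) (n : ℕ) :
    Real.Gamma (s + n + 1) = Real.Gamma s * ∏ j ∈ Finset.range (n + 1), (s + j) := by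
  induction n with
  | zero => simp [Real.Gamma_add_one hs.ne', mul_comm]
  | succ n ih =>
    have h : s + (n : ℝ) + 1 ≠ 0 := by positivity
    rw [Finset.prod_range_succ, ← mul_assoc, ← ih]
    push_cast
    rw [show s + ((n : ℝ) + 1) + 1 = (s + n + 1) + 1 by ring, Real.Gamma_add_one h]
    ring

/-- Obtained by dividing Euler's limit formulas for `Γ(a)` and `Γ(b)`. -/
theorem tendsto_rpow_mul_Gamma_ratio {a b : ℝ} (ha : 0 < a) (hb : 0 < b) :
    Tendsto (fun k : ℕ => ((k : ℝ) + 1) ^ (b - a) * Real.Gamma (k + a) / Real.Gamma (k + b))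
      atTop (𝓝 1) := by
  rw [← tendsto_add_atTop_iff_nat 1]
  have h1 : Tendsto (fun n : ℕ => Real.GammaSeq b n / Real.GammaSeq a n *
      (Real.Gamma a / Real.Gamma b) * (((n : ℝ) + 2) / n) ^ (b - a)) atTop
      (𝓝 (Real.Gamma b / Real.Gamma a * (Real.Gamma a / Real.Gamma b) * 1 ^ (b - a))) := by
    refine ((((Real.GammaSeq_tendsto_Gamma b).div (Real.GammaSeq_tendsto_Gamma a)
      (Real.Gamma_pos_of_pos ha).ne').mul_const _)).mul ?_
    refine Tendsto.rpow_const ?_ (Or.inl one_ne_zero)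
    have : Tendsto (fun n : ℕ => 1 + 2 / (n : ℝ)) atTop (𝓝 (1 + 0)) :=
      (tendsto_const_div_atTop_nhds_zero_nat 2).const_add 1
    rw [add_zero] at this
    refine this.congr' ?_
    filter_upwards [eventually_gt_atTop 0] with n hn
    have : (n : ℝ) ≠ 0 := by positivity
    field_simp
  have hGa := (Real.Gamma_pos_of_pos ha).ne'
  have hGb := (Real.Gamma_pos_of_pos hb).ne'
  have e : Real.Gamma b / Real.Gamma a * (Real.Gamma a / Real.Gamma b) * 1 ^ (b - a) = 1 := by
    rw [Real.one_rpow]; field_simp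
  rw [e] at h1
  refine h1.congr' ?_
  filter_upwards [eventually_gt_atTop 0] with n hn
  have hn' : (0 : ℝ) < n := by positivity
  have hp : ∀ {s : ℝ}, 0 < s → 0 < ∏ j ∈ Finset.range (n + 1), (s + (j : ℝ)) := fun hs =>
    Finset.prod_pos fun j _ => by positivity
  push_cast
  rw [show (n : ℝ) + 1 + a = a + n + 1 by ring, show (n : ℝ) + 1 + b = b + n + 1 by ring,
    Gamma_add_nat_add_one ha, Gamma_add_nat_add_one hb, Real.GammaSeq, Real.GammaSeq,
    Real.div_rpow (by positivity) hn'.le, Real.rpow_sub hn',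
    show (n : ℝ) + 1 + 1 = n + 2 by ring]
  have := (hp ha).ne'
  have := (hp hb).ne'
  have := (Real.rpow_pos_of_pos hn' a).ne'
  have := (Real.rpow_pos_of_pos hn' b).ne'
  have : ((n.factorial : ℕ) : ℝ) ≠ 0 := by positivity
  field_simp

/-- Comparison of the coefficients of `besselSeries lam` with those of `cosh`: the duplication formula
turns `(2k)!` into `4 ^ k k! Γ(k + 1/2) / √π`. -/
theorem exists_rpow_mul_factorial_le_Gamma {lam : ℝ} (hlam : -1 / 2 < lam) :
    ∃ C : ℝ, 0 < C ∧ ∀ k : ℕ, ((k : ℝ) + 1) ^ lam * ((2 * k).factorial : ℝ) ≤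
      C * ((4 : ℝ) ^ k * k.factorial * Real.Gamma (k + lam + 1 / 2)) := by
  have hb : 0 < lam + 1 / 2 := by linarith
  obtain ⟨C, hC⟩ := (tendsto_rpow_mul_Gamma_ratio one_half_pos hb).bddAbove_range
  have hC1 := fun k => hC (Set.mem_range_self k)
  simp only [add_sub_cancel_right] at hC1
  have hpi : 0 < √Real.pi := Real.sqrt_pos.2 Real.pi_pos
  refine ⟨max C 1 / √Real.pi, by positivity, fun k => ?_⟩
  have hG : 0 < Real.Gamma (k + (lam + 1 / 2)) := Real.Gamma_pos_of_pos (by positivity)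
  have h := (div_le_iff₀ hG).1 ((hC1 k).trans (le_max_left _ 1))
  have hd := Real.Gamma_mul_Gamma_add_half_of_pos (s := (k : ℝ) + 1 / 2) (by positivity)
  rw [show (k : ℝ) + 1 / 2 + 1 / 2 = k + 1 by ring, Real.Gamma_nat_eq_factorial,
    show 2 * ((k : ℝ) + 1 / 2) = ((2 * k : ℕ) : ℝ) + 1 by push_cast; ring,
    Real.Gamma_nat_eq_factorial,
    show (1 : ℝ) - (((2 * k : ℕ) : ℝ) + 1) = -((2 * k : ℕ) : ℝ) by ring,
    Real.rpow_neg two_pos.le, Real.rpow_natCast, pow_mul] at hd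
  norm_num at hd
  have hd' : ((2 * k).factorial : ℝ) = 4 ^ k * k.factorial * Real.Gamma (k + 1 / 2) / √Real.pi := by
    field_simp
    field_simp at hd
    linarith
  rw [hd', add_assoc (k : ℝ)]
  calc _ = 4 ^ k * k.factorial / √Real.pi * (((k : ℝ) + 1) ^ lam * Real.Gamma (k + 1 / 2)) := by
        ring
    _ ≤ 4 ^ k * k.factorial / √Real.pi * (max C 1 * Real.Gamma (k + (lam + 1 / 2))) := by gcongr
    _ = _ := by ring

/-! ### The power series of the modified Bessel function -/

theorem hasSum_pow_div_factorial (z : ℝ) :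
    HasSum (fun j : ℕ => z ^ j / (j.factorial : ℝ)) (Real.exp z) := by
  rw [Real.exp_eq_exp_ℝ]; exact NormedSpace.expSeries_div_hasSum_exp z

theorem hasSum_succ_mul_pow_div_factorial (z : ℝ) :
    HasSum (fun j : ℕ => ((j : ℝ) + 1) * (z ^ j / (j.factorial : ℝ)))
      ((1 + z) * Real.exp z) := by
  have h1 : HasSum (fun j : ℕ => (j : ℝ) * (z ^ j / (j.factorial : ℝ))) (z * Real.exp z) := by
    rw [← hasSum_nat_add_iff' 1]
    simp only [Finset.range_one, Finset.sum_singleton, Nat.cast_zero, zero_mul, sub_zero]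
    refine ((hasSum_pow_div_factorial z).mul_left z).congr_fun fun j => ?_
    rw [Nat.factorial_succ]
    push_cast
    have : (j.factorial : ℝ) ≠ 0 := by positivity
    field_simp
    ring
  convert! h1.add (hasSum_pow_div_factorial z) using 1
  · ext j; ring
  · ring

theorem rpow_le_inv_add_pow {lam : ℝ} (hlam : -1 < lam) {m : ℕ} (hm : lam ≤ m) {t : ℝ}
    (ht : 0 < t) : t ^ lam ≤ t⁻¹ + t ^ m := by
  rcases le_total 1 t with h | h
  · have := Real.rpow_le_rpow_of_exponent_le h hm
    rw [Real.rpow_natCast] at this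
    have : 0 < t⁻¹ := by positivity
    linarith
  · have := Real.rpow_le_rpow_of_exponent_ge ht h hlam.le
    rw [Real.rpow_neg_one] at this
    have : 0 < t ^ m := by positivity
    linarith

theorem factorial_two_mul_add_le (k m : ℕ) :
    (2 * k + m).factorial ≤ (2 * k).factorial * ((m + 2) * (k + 1)) ^ m := by
  rw [← Nat.factorial_mul_ascFactorial]
  gcongr
  refine (Nat.ascFactorial_le_pow_add _ _).trans (Nat.pow_le_pow_left ?_ _)
  nlinarith

theorem one_add_pow_le {z : ℝ} (hz : 0 ≤ z) (m : ℕ) : (1 + z) ^ m ≤ 2 ^ m * (1 + z ^ m) := by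
  rw [mul_add, mul_one, ← mul_pow]
  rcases le_total z 1 with h | h
  · have : (1 + z) ^ m ≤ 2 ^ m := by gcongr; linarith
    have : 0 ≤ (2 * z) ^ m := by positivity
    linarith
  · have : (1 + z) ^ m ≤ (2 * z) ^ m := by gcongr; linarith
    have : (0 : ℝ) ≤ 2 ^ m := by positivity
    linarith

/-- The entire function `∑ₖ (z/2)^(2k) / (k! Γ(k + lam + 1/2))`, that is
`(z/2)^(-ν) I_ν(z)` with `ν = lam - 1/2`. -/
noncomputable def besselSeries (lam z : ℝ) : ℝ :=
  ∑' k : ℕ, (z / 2) ^ (2 * k) / ((k.factorial : ℝ) * Real.Gamma (k + lam + 1 / 2))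

theorem Gamma_coeff_pos {lam : ℝ} (hlam : -1 / 2 < lam) (k : ℕ) :
    0 < Real.Gamma (k + lam + 1 / 2) :=
  Real.Gamma_pos_of_pos (by have : (0 : ℝ) ≤ k := by positivity
                            linarith)

theorem besselSeries_term_nonneg {lam : ℝ} (hlam : -1 / 2 < lam) (z : ℝ) (k : ℕ) :
    0 ≤ (z / 2) ^ (2 * k) / ((k.factorial : ℝ) * Real.Gamma (k + lam + 1 / 2)) := by
  have := Gamma_coeff_pos hlam k
  rw [pow_mul]
  positivity

/-- The growth bound for the Bessel function. The `k`-th term is at most a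
constant times `(k + 1) ^ (-lam) z ^ (2k) / (2k)!`, and `((1 + z) / (k + 1)) ^ lam` is at most the sum of
its values for the integer exponents `-1` and `m ≥ lam`; for these, the series is dominated by series
whose terms are terms of the exponential series, up to shifts of the index and a factor linear in it. -/
theorem exists_summable_besselSeries_le {lam : ℝ} (hlam : -1 / 2 < lam) :
    ∃ C : ℝ, 0 < C ∧ ∀ z : ℝ, 0 ≤ z →
      Summable (fun k : ℕ =>
        (z / 2) ^ (2 * k) / ((k.factorial : ℝ) * Real.Gamma (k + lam + 1 / 2))) ∧
      besselSeries lam z ≤ C * (1 + z) ^ (-lam) * Real.exp z := by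
  obtain ⟨C, hC, hle⟩ := exists_rpow_mul_factorial_le_Gamma hlam
  obtain ⟨m, hm⟩ := exists_nat_ge lam
  set D : ℝ := (m + 2 : ℝ) ^ m with hD
  refine ⟨C * (1 + 2 ^ m + 2 ^ m * D), by positivity, fun z hz => ?_⟩
  set T : ℕ → ℝ := fun k =>
    (z / 2) ^ (2 * k) / ((k.factorial : ℝ) * Real.Gamma (k + lam + 1 / 2)) with hT
  set e : ℕ → ℝ := fun j => z ^ j / (j.factorial : ℝ) with he
  have he0 : ∀ j, 0 ≤ e j := fun j => by positivity
  have hz1 : 0 < 1 + z := by linarith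
  set G : ℕ → ℝ := fun k => (1 + z)⁻¹ * ((((2 * k : ℕ) : ℝ) + 1) * e (2 * k)) +
    (2 ^ m * e (2 * k) + 2 ^ m * D * e (2 * k + m)) with hG
  have i1 : Function.Injective (fun k : ℕ => 2 * k) := fun a b h => by simpa using h
  have i2 : Function.Injective (fun k : ℕ => 2 * k + m) := fun a b h => by simpa using h
  have s0 := hasSum_pow_div_factorial z
  have s1 := hasSum_succ_mul_pow_div_factorial z
  have b1 := tsum_comp_le_tsum_of_inj s1.summable (fun j => by positivity) i1
  have b2 := tsum_comp_le_tsum_of_inj s0.summable he0 i1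
  have b3 := tsum_comp_le_tsum_of_inj s0.summable he0 i2
  have t1 := s1.summable.comp_injective i1
  have t2 := s0.summable.comp_injective i1
  have t3 := s0.summable.comp_injective i2
  rw [s1.tsum_eq] at b1
  rw [s0.tsum_eq] at b2 b3
  have hGs : HasSum G _ := (t1.hasSum.mul_left (1 + z)⁻¹).add
    ((t2.hasSum.mul_left (2 ^ m)).add (t3.hasSum.mul_left (2 ^ m * D)))
  have hterm : ∀ k, T k ≤ C * (1 + z) ^ (-lam) * G k := by
    intro k
    have hg := Gamma_coeff_pos hlam k
    have hk : (0 : ℝ) < (k : ℝ) + 1 := by positivity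
    have hkl : 0 < ((k : ℝ) + 1) ^ lam := Real.rpow_pos_of_pos hk _
    have hzl : 0 < (1 + z) ^ lam := Real.rpow_pos_of_pos hz1 _
    have h1 : T k ≤ C * (((k : ℝ) + 1) ^ lam)⁻¹ * e (2 * k) := by
      simp only [hT, he]
      rw [div_pow, pow_mul 2 2 k, div_div, ← mul_assoc]
      norm_num only
      rw [mul_div_assoc', div_le_div_iff₀ (by positivity) (by positivity)]
      rw [mul_comm C, mul_assoc, mul_assoc, inv_mul_eq_div, le_div_iff₀ hkl]
      calc _ = z ^ (2 * k) * (((k : ℝ) + 1) ^ lam * ((2 * k).factorial : ℝ)) := by ring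
        _ ≤ z ^ (2 * k) * (C * ((4 : ℝ) ^ k * k.factorial * Real.Gamma (k + lam + 1 / 2))) := by
          exact mul_le_mul_of_nonneg_left (hle k) (by positivity)
        _ = _ := by ring
    have h2 : (1 + z) ^ lam * (((k : ℝ) + 1) ^ lam)⁻¹ ≤
        ((k : ℝ) + 1) / (1 + z) + (1 + z) ^ m / ((k : ℝ) + 1) ^ m := by
      have := rpow_le_inv_add_pow (by linarith : -1 < lam) hm (div_pos hz1 hk)
      rwa [Real.div_rpow hz1.le hk.le, inv_div, div_pow, div_eq_mul_inv ((1 + z) ^ lam)] at this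
    have h3 : (1 + z) ^ m / ((k : ℝ) + 1) ^ m * e (2 * k) ≤
        2 ^ m * e (2 * k) + 2 ^ m * D * e (2 * k + m) := by
      have hA : z ^ m / ((k : ℝ) + 1) ^ m * e (2 * k) ≤ D * e (2 * k + m) := by
        simp only [he, hD]
        rw [div_mul_div_comm, mul_div_assoc', div_le_div_iff₀ (by positivity) (by positivity)]
        have := factorial_two_mul_add_le k m
        have : ((2 * k + m).factorial : ℝ) ≤
            (2 * k).factorial * ((m + 2 : ℝ) * (k + 1)) ^ m := by exact_mod_cast this
        calc _ ≤ z ^ m * z ^ (2 * k) * ((2 * k).factorial * ((m + 2 : ℝ) * (k + 1)) ^ m) := by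
              gcongr
          _ = _ := by rw [mul_pow, pow_add]; ring
      have hB : e (2 * k) / ((k : ℝ) + 1) ^ m ≤ e (2 * k) :=
        div_le_self (he0 _) (one_le_pow₀ (by have : (0 : ℝ) ≤ k := by positivity
                                             linarith))
      calc _ ≤ 2 ^ m * (1 + z ^ m) / ((k : ℝ) + 1) ^ m * e (2 * k) := by
            gcongr; exact one_add_pow_le hz m
        _ = 2 ^ m * (e (2 * k) / ((k : ℝ) + 1) ^ m) +
            2 ^ m * (z ^ m / ((k : ℝ) + 1) ^ m * e (2 * k)) := by ring
        _ ≤ 2 ^ m * e (2 * k) + 2 ^ m * (D * e (2 * k + m)) := by gcongr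
        _ = _ := by ring
    have h4 : ((k : ℝ) + 1) / (1 + z) * e (2 * k) ≤
        (1 + z)⁻¹ * ((((2 * k : ℕ) : ℝ) + 1) * e (2 * k)) := by
      rw [div_eq_inv_mul, mul_assoc]
      gcongr
      lia
    have h5 : (1 + z) ^ lam * (((k : ℝ) + 1) ^ lam)⁻¹ * e (2 * k) ≤ G k :=
      (mul_le_mul_of_nonneg_right h2 (he0 _)).trans (by rw [add_mul]; exact add_le_add h4 h3)
    calc T k ≤ C * (((k : ℝ) + 1) ^ lam)⁻¹ * e (2 * k) := h1
      _ = C * (1 + z) ^ (-lam) * ((1 + z) ^ lam * (((k : ℝ) + 1) ^ lam)⁻¹ * e (2 * k)) := by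
        rw [Real.rpow_neg hz1.le]; field_simp
      _ ≤ _ := by gcongr
  have hTs : Summable T := Summable.of_nonneg_of_le (besselSeries_term_nonneg hlam z) hterm
    (hGs.summable.mul_left _)
  refine ⟨hTs, ?_⟩
  calc besselSeries lam z ≤ ∑' k, C * (1 + z) ^ (-lam) * G k :=
        hTs.tsum_le_tsum hterm (hGs.summable.mul_left _)
    _ = C * (1 + z) ^ (-lam) * ∑' k, G k := tsum_mul_left
    _ ≤ C * (1 + z) ^ (-lam) * ((1 + z)⁻¹ * ((1 + z) * Real.exp z) +
        (2 ^ m * Real.exp z + 2 ^ m * D * Real.exp z)) := by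
      rw [hGs.tsum_eq]
      gcongr
    _ = _ := by field_simp; ring

/-! ### The one-dimensional heat kernel is Markovian -/

theorem heatKernel_eq_besselSeries (lam : ℝ) {s x y : ℝ} (hs : 0 < s) (hx : 0 < x) (hy : 0 < y) :
    heatKernel lam s x y = (4 * s) ^ (1 / 2 - lam) / (2 * s) * besselSeries lam (x * y / (2 * s)) *
      Real.exp (-(x ^ 2 + y ^ 2) / (4 * s)) := by
  have hxy : 0 < x * y := mul_pos hx hy
  have hz : 0 < x * y / (2 * s) / 2 := by positivity
  have hI : besselI (lam - 1 / 2) (x * y / (2 * s)) =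
      (x * y / (2 * s) / 2) ^ (lam - 1 / 2) * besselSeries lam (x * y / (2 * s)) := by
    rw [besselI, besselSeries, ← tsum_mul_left]
    congr 1 with k
    rw [Real.rpow_add hz, mul_comm, mul_div_assoc']
    congr 2
    · exact_mod_cast Real.rpow_natCast _ (2 * k)
    · congr 1; ring_nf
  have hp : (x * y) ^ (-lam + 1 / 2) * (x * y / (2 * s) / 2) ^ (lam - 1 / 2) =
      (4 * s) ^ (1 / 2 - lam) := by
    rw [show x * y / (2 * s) / 2 = x * y / (4 * s) by ring,
      Real.div_rpow hxy.le (by positivity), show 1 / 2 - lam = -(lam - 1 / 2) by ring,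
      Real.rpow_neg (by positivity), mul_div_assoc', ← Real.rpow_add hxy]
    simp
  rw [heatKernel, hI, ← hp]
  ring

theorem heatKernel_nonneg {lam : ℝ} (hlam : -1 / 2 < lam) {s x y : ℝ} (hs : 0 < s) (hx : 0 < x)
    (hy : 0 < y) : 0 ≤ heatKernel lam s x y := by
  rw [heatKernel_eq_besselSeries lam hs hx hy]
  have : 0 ≤ besselSeries lam (x * y / (2 * s)) :=
    tsum_nonneg (besselSeries_term_nonneg hlam _)
  positivity

theorem lintegral_weight (lam : ℝ) (f : ℝ → ℝ≥0∞) :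
    ∫⁻ y, f y ∂(weight lam) = ∫⁻ y in Set.Ioi 0, ENNReal.ofReal (y ^ (2 * lam)) * f y := by
  rw [weight, lintegral_withDensity_eq_lintegral_mul_non_measurable _ (by fun_prop)
    (ae_of_all _ fun _ => ENNReal.ofReal_lt_top)]
  rfl

theorem weight_apply (lam : ℝ) {S : Set ℝ} (hS : MeasurableSet S) :
    weight lam S = ∫⁻ y in S ∩ Set.Ioi 0, ENNReal.ofReal (y ^ (2 * lam)) := by
  rw [weight, withDensity_apply _ hS, Measure.restrict_restrict hS]

theorem ae_weight_pos (lam : ℝ) : ∀ᵐ y ∂(weight lam), 0 < y :=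
  (withDensity_absolutelyContinuous _ _).ae_le (ae_restrict_mem measurableSet_Ioi)

/-- The coefficient of `y^(2k) exp(-y²/4s)` in the expansion of the heat kernel. -/
noncomputable def heatCoeff (lam s x : ℝ) (k : ℕ) : ℝ :=
  (4 * s) ^ (1 / 2 - lam) / (2 * s) * Real.exp (-x ^ 2 / (4 * s)) *
    ((x / (4 * s)) ^ (2 * k) / ((k.factorial : ℝ) * Real.Gamma (k + lam + 1 / 2)))

theorem heatCoeff_nonneg {lam : ℝ} (hlam : -1 / 2 < lam) {s : ℝ} (hs : 0 < s) (x : ℝ) (k : ℕ) :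
    0 ≤ heatCoeff lam s x k := by
  have := Gamma_coeff_pos hlam k
  have : 0 ≤ (x / (4 * s)) ^ (2 * k) := by rw [pow_mul]; positivity
  rw [heatCoeff]
  positivity

theorem ofReal_heatKernel_eq_tsum {lam : ℝ} (hlam : -1 / 2 < lam) {s x y : ℝ} (hs : 0 < s)
    (hx : 0 < x) (hy : 0 < y) :
    ENNReal.ofReal (heatKernel lam s x y) =
      ∑' k, ENNReal.ofReal (heatCoeff lam s x k * (y ^ (2 * k) * Real.exp (-y ^ 2 / (4 * s)))) := by
  obtain ⟨C, -, hC⟩ := exists_summable_besselSeries_le hlam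
  have hsum := (hC (x * y / (2 * s)) (by positivity)).1
  have hterm : ∀ k : ℕ, heatCoeff lam s x k * (y ^ (2 * k) * Real.exp (-y ^ 2 / (4 * s))) =
      (4 * s) ^ (1 / 2 - lam) / (2 * s) * Real.exp (-(x ^ 2 + y ^ 2) / (4 * s)) *
        ((x * y / (2 * s) / 2) ^ (2 * k) /
          ((k.factorial : ℝ) * Real.Gamma (k + lam + 1 / 2))) := fun k => by
    rw [heatCoeff, show x * y / (2 * s) / 2 = x / (4 * s) * y by ring, mul_pow,
      show -(x ^ 2 + y ^ 2) / (4 * s) = -x ^ 2 / (4 * s) + -y ^ 2 / (4 * s) by ring, Real.exp_add]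
    ring
  rw [← ENNReal.ofReal_tsum_of_nonneg]
  · rw [tsum_congr hterm, tsum_mul_left, heatKernel_eq_besselSeries lam hs hx hy, besselSeries]
    congr 1; ring
  · intro k
    have := heatCoeff_nonneg hlam hs x k
    positivity
  · exact (hsum.mul_left _).congr fun k => (hterm k).symm

theorem aemeasurable_heatKernel {lam : ℝ} (hlam : -1 / 2 < lam) {s x : ℝ} (hs : 0 < s)
    (hx : 0 < x) : AEMeasurable (heatKernel lam s x) (weight lam) := by
  refine ⟨fun y => (∑' k, ENNReal.ofReal
    (heatCoeff lam s x k * (y ^ (2 * k) * Real.exp (-y ^ 2 / (4 * s))))).toReal, ?_, ?_⟩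
  · exact (Measurable.tsum fun k => by fun_prop).ennreal_toReal
  · filter_upwards [ae_weight_pos lam] with y hy
    rw [← ofReal_heatKernel_eq_tsum hlam hs hx hy,
      ENNReal.toReal_ofReal (heatKernel_nonneg hlam hs hx hy)]

/-- The heat kernel is Markovian: integrating the power series term by term turns each summand into
a Gamma integral, which leaves the exponential series of `x²/4s`. -/
theorem lintegral_heatKernel {lam : ℝ} (hlam : -1 / 2 < lam) {s x : ℝ} (hs : 0 < s)
    (hx : 0 < x) : ∫⁻ y, ENNReal.ofReal (heatKernel lam s x y) ∂(weight lam) = 1 := by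
  have hs4 : 0 < 4 * s := by positivity
  have hq : ∀ k : ℕ, -1 < 2 * (k : ℝ) + 2 * lam := fun k => by
    have : (0 : ℝ) ≤ k := by positivity
    linarith
  have hint : ∀ k : ℕ, ∫⁻ y in Set.Ioi (0 : ℝ), ENNReal.ofReal (y ^ (2 * lam)) *
      ENNReal.ofReal (heatCoeff lam s x k * (y ^ (2 * k) * Real.exp (-y ^ 2 / (4 * s)))) =
      ENNReal.ofReal (Real.exp (-x ^ 2 / (4 * s)) *
        ((x ^ 2 / (4 * s)) ^ k / (k.factorial : ℝ))) := by
    intro k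
    have hc := heatCoeff_nonneg hlam hs x k
    have hG := Gamma_coeff_pos hlam k
    have e : ∀ y ∈ Set.Ioi (0 : ℝ), ENNReal.ofReal (y ^ (2 * lam)) *
      ENNReal.ofReal (heatCoeff lam s x k * (y ^ (2 * k) * Real.exp (-y ^ 2 / (4 * s)))) =
      ENNReal.ofReal (heatCoeff lam s x k *
        (y ^ (2 * (k : ℝ) + 2 * lam) * Real.exp (-(4 * s)⁻¹ * y ^ (2 : ℝ)))) := by
      intro y hy
      have hy : 0 < y := hy
      rw [← ENNReal.ofReal_mul (by positivity), Real.rpow_add hy,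
        show 2 * (k : ℝ) = ((2 * k : ℕ) : ℝ) by push_cast; ring, Real.rpow_natCast, Real.rpow_two]
      congr 1
      rw [show -(4 * s)⁻¹ * y ^ 2 = -y ^ 2 / (4 * s) by ring]
      ring
    have hi := integrableOn_rpow_mul_exp_neg_mul_rpow (hq k) two_pos (inv_pos.2 hs4)
    rw [setLIntegral_congr_fun measurableSet_Ioi e, ← ofReal_integral_eq_lintegral_ofReal
      (hi.const_mul _), integral_const_mul,
      integral_rpow_mul_exp_neg_mul_rpow two_pos (hq k) (inv_pos.2 hs4)]
    · congr 1
      rw [heatCoeff, show (2 * (k : ℝ) + 2 * lam + 1) / 2 = k + lam + 1 / 2 by ring,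
        show -(2 * (k : ℝ) + 2 * lam + 1) / 2 = -(k + lam + 1 / 2) by ring,
        Real.inv_rpow hs4.le, Real.rpow_neg hs4.le, inv_inv]
      have e2 : (4 * s) ^ (1 / 2 - lam) * (4 * s) ^ ((k : ℝ) + lam + 1 / 2) =
          (4 * s) ^ (k + 1) := by
        rw [← Real.rpow_add hs4, ← Real.rpow_natCast]
        congr 1
        push_cast; ring
      have e3 : (x / (4 * s)) ^ (2 * k) * (4 * s) ^ (k + 1) = (x ^ 2 / (4 * s)) ^ k * (4 * s) := by
        rw [pow_mul, pow_succ (4 * s), ← mul_assoc, ← mul_pow]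
        congr 2
        field_simp
      generalize Real.Gamma (k + lam + 1 / 2) = g at hG
      calc _ = ((4 * s) ^ (1 / 2 - lam) * (4 * s) ^ ((k : ℝ) + lam + 1 / 2)) *
            (x / (4 * s)) ^ (2 * k) / (4 * s) * (Real.exp (-x ^ 2 / (4 * s)) / k.factorial) := by
            field_simp
            ring
        _ = (x / (4 * s)) ^ (2 * k) * (4 * s) ^ (k + 1) / (4 * s) *
            (Real.exp (-x ^ 2 / (4 * s)) / k.factorial) := by rw [e2]; ring
        _ = _ := by rw [e3]; field_simp
    · filter_upwards [ae_restrict_mem measurableSet_Ioi] with y hy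
      have hy : 0 < y := hy
      simp only [Pi.zero_apply]
      positivity
  calc _ = ∫⁻ y in Set.Ioi (0 : ℝ), ∑' k, ENNReal.ofReal (y ^ (2 * lam)) *
      ENNReal.ofReal (heatCoeff lam s x k * (y ^ (2 * k) * Real.exp (-y ^ 2 / (4 * s)))) := by
        rw [lintegral_weight]
        refine setLIntegral_congr_fun measurableSet_Ioi fun y hy => ?_
        simp only [ofReal_heatKernel_eq_tsum hlam hs hx hy, ENNReal.tsum_mul_left]
    _ = ∑' k : ℕ, ENNReal.ofReal (Real.exp (-x ^ 2 / (4 * s)) *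
        ((x ^ 2 / (4 * s)) ^ k / (k.factorial : ℝ))) := by
      rw [lintegral_tsum fun k => by fun_prop]
      exact tsum_congr hint
    _ = 1 := by
      have h := (hasSum_pow_div_factorial (x ^ 2 / (4 * s))).mul_left (Real.exp (-x ^ 2 / (4 * s)))
      rw [← ENNReal.ofReal_tsum_of_nonneg (fun k => by positivity) h.summable, h.tsum_eq,
        ← Real.exp_add, ← ENNReal.ofReal_one]
      congr 1
      rw [← Real.exp_zero]
      congr 1
      ring

/-! ### Measures of intervals and pointwise bounds for the one-dimensional kernel -/

theorem rpow_le_mul_rpow_of_comparable {a b L : ℝ} (ha : 0 < a) (hb : 0 < b) (hL : 1 ≤ L)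
    (hab : a ≤ L * b) (hba : b ≤ L * a) (e : ℝ) : a ^ e ≤ L ^ |e| * b ^ e := by
  have hL0 : 0 < L := by linarith
  rcases le_total 0 e with he | he
  · rw [abs_of_nonneg he, ← Real.mul_rpow hL0.le hb.le]
    exact Real.rpow_le_rpow ha.le hab he
  · rw [abs_of_nonpos he, Real.rpow_neg hL0.le, inv_mul_eq_div,
      le_div_iff₀ (Real.rpow_pos_of_pos hL0 _), mul_comm, ← Real.mul_rpow hL0.le ha.le]
    exact Real.rpow_le_rpow_of_nonpos hb hba he

/-- The size `ρ (x + ρ)^(2 lam)` of the interval `[x - ρ, x + ρ]` for the measure `weight lam`, up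
to constants depending only on `lam`. -/
noncomputable def ballSize (lam x ρ : ℝ) : ℝ := ρ * (x + ρ) ^ (2 * lam)

theorem ballSize_pos (lam : ℝ) {x ρ : ℝ} (hx : 0 < x) (hρ : 0 < ρ) : 0 < ballSize lam x ρ :=
  mul_pos hρ (Real.rpow_pos_of_pos (by linarith) _)

theorem ballSize_mul_le (lam : ℝ) {x ρ L : ℝ} (hx : 0 < x) (hρ : 0 < ρ) (hL : 1 ≤ L) :
    ballSize lam x (L * ρ) ≤ L * L ^ |2 * lam| * ballSize lam x ρ := by
  have hL0 : 0 < L := by linarith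
  have h := rpow_le_mul_rpow_of_comparable (a := x + L * ρ) (b := x + ρ) (L := L)
    (by positivity) (by positivity) hL (by nlinarith) (by nlinarith [mul_pos hL0 hρ]) (2 * lam)
  calc ballSize lam x (L * ρ) ≤ L * ρ * (L ^ |2 * lam| * (x + ρ) ^ (2 * lam)) := by
        rw [ballSize]; gcongr
    _ = _ := by rw [ballSize]; ring

theorem ballSize_le_weight (lam : ℝ) {x ρ : ℝ} (hx : 0 < x) (hρ : 0 < ρ) :
    ENNReal.ofReal ((2 * 2 ^ |2 * lam|)⁻¹ * ballSize lam x ρ) ≤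
      weight lam (Set.Icc (x - ρ) (x + ρ)) := by
  have h2 : (0 : ℝ) < 2 ^ |2 * lam| := by positivity
  rw [weight_apply lam measurableSet_Icc]
  calc ENNReal.ofReal ((2 * 2 ^ |2 * lam|)⁻¹ * ballSize lam x ρ)
      = ∫⁻ _ in Set.Icc (x + ρ / 2) (x + ρ),
          ENNReal.ofReal ((2 ^ |2 * lam|)⁻¹ * (x + ρ) ^ (2 * lam)) := by
        rw [setLIntegral_const, Real.volume_Icc, ← ENNReal.ofReal_mul (by positivity), ballSize]
        congr 1
        rw [mul_inv]; ring
    _ ≤ ∫⁻ y in Set.Icc (x + ρ / 2) (x + ρ), ENNReal.ofReal (y ^ (2 * lam)) := by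
        refine setLIntegral_mono' measurableSet_Icc fun y hy => ENNReal.ofReal_le_ofReal ?_
        have := rpow_le_mul_rpow_of_comparable (a := x + ρ) (b := y) (L := 2) (by positivity)
          (by linarith [hy.1]) one_le_two (by linarith [hy.1]) (by linarith [hy.2]) (2 * lam)
        rwa [inv_mul_le_iff₀ h2]
    _ ≤ _ := by
        refine lintegral_mono_set fun y hy => ⟨⟨?_, hy.2⟩, ?_⟩
        · linarith [hy.1]
        · exact lt_of_lt_of_le (by positivity) hy.1

theorem lintegral_rpow_Ioc_zero {lam : ℝ} (hlam : -1 / 2 < lam) {R : ℝ} (hR : 0 ≤ R) :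
    ∫⁻ y in Set.Ioc 0 R, ENNReal.ofReal (y ^ (2 * lam)) =
      ENNReal.ofReal (R ^ (2 * lam + 1) / (2 * lam + 1)) := by
  have h1 : -1 < 2 * lam := by linarith
  have hi := (intervalIntegrable_iff_integrableOn_Ioc_of_le hR).1
    (intervalIntegral.intervalIntegrable_rpow' (a := 0) (b := R) h1)
  rw [← ofReal_integral_eq_lintegral_ofReal hi, ← intervalIntegral.integral_of_le hR,
    integral_rpow (Or.inl h1), Real.zero_rpow (by linarith), sub_zero]
  filter_upwards [ae_restrict_mem measurableSet_Ioc] with y hy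
  exact Real.rpow_nonneg hy.1.le _

theorem exists_weight_le_ballSize {lam : ℝ} (hlam : -1 / 2 < lam) :
    ∃ C : ℝ, 0 < C ∧ ∀ {x ρ : ℝ}, 0 < x → 0 < ρ →
      weight lam (Set.Icc (x - ρ) (x + ρ)) ≤ ENNReal.ofReal (C * ballSize lam x ρ) := by
  have h1 : 0 < 2 * lam + 1 := by linarith
  refine ⟨max (2 * 3 ^ |2 * lam|) (3 / (2 * lam + 1)), by positivity, fun {x ρ} hx hρ => ?_⟩
  have hb := ballSize_pos lam hx hρ
  have hxr : 0 < x + ρ := by linarith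
  rw [weight_apply lam measurableSet_Icc]
  rcases le_total ρ (x / 2) with h | h
  · calc _ ≤ ∫⁻ y in Set.Icc (x - ρ) (x + ρ), ENNReal.ofReal (y ^ (2 * lam)) :=
          lintegral_mono_set Set.inter_subset_left
      _ ≤ ∫⁻ _ in Set.Icc (x - ρ) (x + ρ), ENNReal.ofReal (3 ^ |2 * lam| * (x + ρ) ^ (2 * lam)) := by
          refine setLIntegral_mono' measurableSet_Icc fun y hy => ENNReal.ofReal_le_ofReal ?_
          exact rpow_le_mul_rpow_of_comparable (by linarith [hy.1]) hxr (by norm_num)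
            (by linarith [hy.2]) (by linarith [hy.1]) _
      _ = ENNReal.ofReal (2 * 3 ^ |2 * lam| * ballSize lam x ρ) := by
          rw [setLIntegral_const, Real.volume_Icc, ← ENNReal.ofReal_mul (by positivity), ballSize]
          congr 1; ring
      _ ≤ _ := by gcongr; exact le_max_left _ _
  · calc _ ≤ ∫⁻ y in Set.Ioc 0 (x + ρ), ENNReal.ofReal (y ^ (2 * lam)) :=
          lintegral_mono_set fun y hy => ⟨hy.2, hy.1.2⟩
      _ = ENNReal.ofReal ((x + ρ) * (x + ρ) ^ (2 * lam) / (2 * lam + 1)) := by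
          rw [lintegral_rpow_Ioc_zero hlam hxr.le, Real.rpow_add_one hxr.ne', mul_comm]
      _ ≤ ENNReal.ofReal (3 / (2 * lam + 1) * ballSize lam x ρ) := by
          refine ENNReal.ofReal_le_ofReal ?_
          rw [div_mul_eq_mul_div, ballSize, ← mul_assoc]
          gcongr
          linarith
      _ ≤ _ := by gcongr; exact le_max_right _ _

theorem exists_weight_doubling {lam : ℝ} (hlam : -1 / 2 < lam) :
    ∃ D : ℝ≥0, ∀ {x ρ : ℝ}, 0 < x → 0 < ρ →
      weight lam (Set.Icc (x - 3 * ρ) (x + 3 * ρ)) ≤ D * weight lam (Set.Icc (x - ρ) (x + ρ)) := by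
  obtain ⟨C, hC, hle⟩ := exists_weight_le_ballSize hlam
  refine ⟨Real.toNNReal (C * (3 * 3 ^ |2 * lam|) * (2 * 2 ^ |2 * lam|)), fun {x ρ} hx hρ => ?_⟩
  have hb := ballSize_pos lam hx hρ
  calc _ ≤ ENNReal.ofReal (C * ballSize lam x (3 * ρ)) := hle hx (by positivity)
    _ ≤ ENNReal.ofReal (C * (3 * 3 ^ |2 * lam| * ballSize lam x ρ)) := by
      gcongr; exact ballSize_mul_le lam hx hρ (by norm_num)
    _ = ENNReal.ofReal (C * (3 * 3 ^ |2 * lam|) * (2 * 2 ^ |2 * lam|)) *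
        ENNReal.ofReal ((2 * 2 ^ |2 * lam|)⁻¹ * ballSize lam x ρ) := by
      rw [← ENNReal.ofReal_mul (by positivity)]
      congr 1
      have : (0 : ℝ) < 2 ^ |2 * lam| := by positivity
      field_simp
    _ ≤ _ := by
      exact mul_le_mul' le_rfl (ballSize_le_weight lam hx hρ)

theorem isLocallyFiniteMeasure_weight {lam : ℝ} (hlam : -1 / 2 < lam) :
    IsLocallyFiniteMeasure (weight lam) := by
  refine ⟨fun x => ⟨Set.Icc (x - 1) (x + 1), Icc_mem_nhds (by linarith) (by linarith), ?_⟩⟩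
  rw [weight_apply lam measurableSet_Icc]
  calc _ ≤ ∫⁻ y in Set.Ioc 0 (|x| + 1), ENNReal.ofReal (y ^ (2 * lam)) :=
        lintegral_mono_set fun y hy => ⟨hy.2, hy.1.2.trans (by gcongr; exact le_abs_self x)⟩
    _ < ∞ := by
        rw [lintegral_rpow_Ioc_zero hlam (by positivity)]
        exact ENNReal.ofReal_lt_top

theorem exists_one_add_pow_mul_exp_le (M : ℕ) : ∃ C : ℝ, 0 < C ∧ ∀ u : ℝ, 0 ≤ u →
    (1 + u) ^ M * Real.exp (-u ^ 2 / 4) ≤ C * Real.exp (-(3 * u)) := by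
  refine ⟨M.factorial * Real.exp 17, by positivity, fun u hu => ?_⟩
  have h := Real.pow_div_factorial_le_exp (1 + u) (by linarith) M
  rw [div_le_iff₀ (by positivity)] at h
  calc _ ≤ Real.exp (1 + u) * M.factorial * Real.exp (-u ^ 2 / 4) := by gcongr
    _ = M.factorial * Real.exp (1 + u + -u ^ 2 / 4) := by rw [Real.exp_add (1 + u)]; ring
    _ ≤ M.factorial * Real.exp (17 + -(3 * u)) := by
        have : 1 + u + -u ^ 2 / 4 ≤ 17 + -(3 * u) := by
          -- the difference of the two sides is `(u / 2 - 4) ^ 2`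
          nlinarith [sq_nonneg (u / 2 - 4)]
        gcongr
    _ = _ := by rw [Real.exp_add 17]; ring

/-- Upper bound for the heat kernel by the size of the interval of radius `√s` and a rapidly
decreasing function of the distance on the scale `√s`. -/
theorem exists_heatKernel_le {lam : ℝ} (hlam : -1 / 2 < lam) :
    ∃ C : ℝ, 0 < C ∧ ∀ {s x y : ℝ}, 0 < s → 0 < x → 0 < y →
      heatKernel lam s x y ≤ C * Real.exp (-(3 * (|x - y| / √s))) / ballSize lam x √s := by
  obtain ⟨A, hA, hle⟩ := exists_summable_besselSeries_le hlam
  obtain ⟨M, hM⟩ := exists_nat_ge |lam|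
  obtain ⟨B, hB, hexp⟩ := exists_one_add_pow_mul_exp_le (2 * M)
  refine ⟨4 ^ (1 / 2 - lam) / 2 * A * 8 ^ M * B, by positivity, fun {s x y} hs hx hy => ?_⟩
  have hxy : 0 < x * y := mul_pos hx hy
  set q := √s with hq
  have hq0 : 0 < q := Real.sqrt_pos.2 hs
  have hqs : q ^ 2 = s := Real.sq_sqrt hs.le
  set u := |x - y| / q with hu
  have hu0 : 0 ≤ u := by positivity
  have huq : u * q = |x - y| := by rw [hu]; field_simp
  have hu2 : u ^ 2 * s = (x - y) ^ 2 := by rw [← hqs, ← mul_pow, huq, sq_abs]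
  have hz : 0 < s + x * y / 2 := by positivity
  have hxq : 0 < x + q := by positivity
  -- `s + x y / 2` and `(x + √s) ^ 2` are comparable up to a factor polynomial in the distance `u`
  set L : ℝ := 8 * (1 + u) ^ 2 with hL
  have hL1 : 1 ≤ L := by nlinarith
  have hx1 : x ≤ y + u * q := by rw [huq]; linarith [le_abs_self (x - y)]
  have hy1 : y ≤ x + u * q := by rw [huq]; linarith [neg_abs_le (x - y)]
  have hcmp : (s + x * y / 2) ^ (-lam) ≤ L ^ |lam| * ((x + q) ^ (2 * lam))⁻¹ := by
    have h := rpow_le_mul_rpow_of_comparable (a := s + x * y / 2) (b := (x + q) ^ 2) hz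
      (by positivity) hL1 ?_ ?_ (-lam)
    · rwa [abs_neg, ← Real.rpow_natCast, ← Real.rpow_mul hxq.le, Nat.cast_two, mul_neg,
        Real.rpow_neg hxq.le] at h
    · have h1 : x * y ≤ x * (x + u * q) := by gcongr
      have h2 : s + x * y / 2 ≤ (1 + u) * (x + q) ^ 2 := by
        rw [← hqs]
        nlinarith [mul_pos hx hq0, mul_nonneg hu0 (mul_pos hx hq0).le, mul_nonneg hu0 (sq_nonneg x),
          mul_nonneg hu0 (sq_nonneg q), sq_nonneg x]
      refine h2.trans ?_
      gcongr
      nlinarith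
    · have h1 : x * x ≤ x * (y + u * q) := by gcongr
      have h2 : x ^ 2 ≤ 2 * (x * y) + u ^ 2 * s := by
        rw [← hqs]; nlinarith [sq_nonneg (x - u * q)]
      have h3 : (x + q) ^ 2 ≤ 8 * (1 + u ^ 2) * (s + x * y / 2) := by
        have : (x + q) ^ 2 ≤ 2 * x ^ 2 + 2 * s := by
          rw [← hqs]; nlinarith [sq_nonneg (x - q)]
        nlinarith [mul_nonneg (sq_nonneg u) hxy.le, mul_nonneg (sq_nonneg u) hs.le]
      refine h3.trans ?_
      rw [hL]
      gcongr
      nlinarith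
  have hLM : L ^ |lam| ≤ 8 ^ M * (1 + u) ^ (2 * M) := by
    rw [pow_mul (1 + u), ← mul_pow, ← hL, ← Real.rpow_natCast]
    exact Real.rpow_le_rpow_of_exponent_le hL1 hM
  have hser := (hle (x * y / (2 * s)) (by positivity)).2
  have hexp2 : Real.exp (x * y / (2 * s)) * Real.exp (-(x ^ 2 + y ^ 2) / (4 * s)) =
      Real.exp (-u ^ 2 / 4) := by
    rw [← Real.exp_add]
    congr 1
    rw [show u ^ 2 = (x - y) ^ 2 / s by rw [← hu2]; field_simp]
    field_simp
    ring
  have hscale : (4 * s) ^ (1 / 2 - lam) / (2 * s) * (1 + x * y / (2 * s)) ^ (-lam) =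
      4 ^ (1 / 2 - lam) / 2 * (q⁻¹ * (s + x * y / 2) ^ (-lam)) := by
    rw [show 1 + x * y / (2 * s) = (s + x * y / 2) / s by field_simp,
      Real.div_rpow hz.le hs.le, Real.mul_rpow (by norm_num) hs.le, sub_eq_add_neg,
      Real.rpow_add hs, ← Real.sqrt_eq_rpow, ← hq]
    have h1 : s ^ (-lam) ≠ 0 := (Real.rpow_pos_of_pos hs _).ne'
    field_simp
    rw [hqs]
  rw [heatKernel_eq_besselSeries lam hs hx hy]
  calc _ ≤ (4 * s) ^ (1 / 2 - lam) / (2 * s) * (A * (1 + x * y / (2 * s)) ^ (-lam) *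
          Real.exp (x * y / (2 * s))) * Real.exp (-(x ^ 2 + y ^ 2) / (4 * s)) := by gcongr
    _ = A * ((4 * s) ^ (1 / 2 - lam) / (2 * s) * (1 + x * y / (2 * s)) ^ (-lam)) *
        (Real.exp (x * y / (2 * s)) * Real.exp (-(x ^ 2 + y ^ 2) / (4 * s))) := by ring
    _ = 4 ^ (1 / 2 - lam) / 2 * A * q⁻¹ * (s + x * y / 2) ^ (-lam) * Real.exp (-u ^ 2 / 4) := by
      rw [hscale, hexp2]; ring
    _ ≤ 4 ^ (1 / 2 - lam) / 2 * A * q⁻¹ * (8 ^ M * (1 + u) ^ (2 * M) *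
        ((x + q) ^ (2 * lam))⁻¹) * Real.exp (-u ^ 2 / 4) := by
      gcongr
      exact hcmp.trans (by gcongr)
    _ = 4 ^ (1 / 2 - lam) / 2 * A * 8 ^ M * ((1 + u) ^ (2 * M) * Real.exp (-u ^ 2 / 4)) /
        ballSize lam x q := by
      rw [ballSize]; field_simp
    _ ≤ 4 ^ (1 / 2 - lam) / 2 * A * 8 ^ M * (B * Real.exp (-(3 * u))) / ballSize lam x q := by
      have := ballSize_pos lam hx hq0
      gcongr ?_ / _
      exact mul_le_mul_of_nonneg_left (hexp u hu0) (by positivity)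
    _ = _ := by ring

/-- The product of the heat kernel with the measure of the interval of radius `K √s`. -/
theorem exists_heatKernel_mul_weight_le {lam : ℝ} (hlam : -1 / 2 < lam) :
    ∃ C : ℝ, 0 < C ∧ ∃ N : ℕ, ∀ {s x y K : ℝ}, 0 < s → 0 < x → 0 < y → 1 ≤ K →
      ENNReal.ofReal (heatKernel lam s x y) * weight lam (Set.Icc (x - K * √s) (x + K * √s)) ≤
        ENNReal.ofReal (C * K ^ N * Real.exp (-(3 * (|x - y| / √s)))) := by
  obtain ⟨A, hA, hA'⟩ := exists_heatKernel_le hlam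
  obtain ⟨B, hB, hB'⟩ := exists_weight_le_ballSize hlam
  obtain ⟨M, hM⟩ := exists_nat_ge |2 * lam|
  refine ⟨A * B, by positivity, M + 1, fun {s x y K} hs hx hy hK => ?_⟩
  have hK0 : 0 < K := by linarith
  have hq0 : 0 < √s := Real.sqrt_pos.2 hs
  have hb := ballSize_pos lam hx hq0
  have hKM : K * K ^ |2 * lam| ≤ K ^ (M + 1) := by
    rw [pow_succ', ← Real.rpow_natCast]
    gcongr
  calc _ ≤ ENNReal.ofReal (A * Real.exp (-(3 * (|x - y| / √s))) / ballSize lam x √s) *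
        ENNReal.ofReal (B * ballSize lam x (K * √s)) := by
        gcongr
        exacts [hA' hs hx hy, hB' hx (by positivity)]
    _ ≤ ENNReal.ofReal (A * Real.exp (-(3 * (|x - y| / √s))) / ballSize lam x √s) *
        ENNReal.ofReal (B * (K ^ (M + 1) * ballSize lam x √s)) := by
        gcongr
        exact (ballSize_mul_le lam hx hq0 hK).trans (by gcongr)
    _ = _ := by
        rw [← ENNReal.ofReal_mul (by positivity)]
        congr 1
        field_simp

/-! ### Boxes, weak type estimates and pointwise bounds in several variables -/

instance sigmaFinite_weight (lam : ℝ) : SigmaFinite (weight lam) := by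
  unfold weight
  exact SigmaFinite.withDensity_ofReal _

variable {n : ℕ}

theorem ae_mu_pos (lam : Fin n → ℝ) : ∀ᵐ y ∂(mu lam), ∀ j, 0 < y j :=
  ae_all_iff.2 fun j =>
    (Measure.quasiMeasurePreserving_eval (μ := fun j => weight (lam j)) j).ae (ae_weight_pos _)

theorem isLocallyFiniteMeasure_mu {lam : Fin n → ℝ} (hlam : ∀ j, -1 / 2 < lam j) :
    IsLocallyFiniteMeasure (mu lam) := by
  have := fun j => isLocallyFiniteMeasure_weight (hlam j)
  unfold mu
  infer_instance

/-- The closed box with centre `x` and half side lengths `ρ`. -/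
def box (x ρ : Fin n → ℝ) : Set (Fin n → ℝ) := Set.Icc (x - ρ) (x + ρ)

theorem measurableSet_box (x ρ : Fin n → ℝ) : MeasurableSet (box x ρ) := measurableSet_Icc

theorem box_mem_nhds (x : Fin n → ℝ) {ρ : Fin n → ℝ} (hρ : ∀ j, 0 < ρ j) : box x ρ ∈ 𝓝 x := by
  rw [box, ← Set.pi_univ_Icc]
  exact set_pi_mem_nhds Set.finite_univ fun j _ =>
    Icc_mem_nhds (by simpa using hρ j) (by simpa using hρ j)

theorem mem_box_iff {x ρ y : Fin n → ℝ} : y ∈ box x ρ ↔ ∀ j, |x j - y j| ≤ ρ j := by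
  simp only [box, Set.mem_Icc, Pi.le_def, Pi.sub_apply, Pi.add_apply, ← forall_and, abs_le]
  refine forall_congr' fun j => ⟨fun h => ⟨?_, ?_⟩, fun h => ⟨?_, ?_⟩⟩ <;> linarith [h.1, h.2]

theorem mu_box (lam x ρ : Fin n → ℝ) :
    mu lam (box x ρ) = ∏ j, weight (lam j) (Set.Icc (x j - ρ j) (x j + ρ j)) := by
  rw [mu, box, ← Set.pi_univ_Icc, Measure.pi_pi]
  rfl

theorem mu_box_pos (lam : Fin n → ℝ) {x ρ : Fin n → ℝ} (hx : ∀ j, 0 < x j)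
    (hρ : ∀ j, 0 < ρ j) : mu lam (box x ρ) ≠ 0 := by
  rw [mu_box]
  refine Finset.prod_ne_zero_iff.2 fun j _ => (lt_of_lt_of_le ?_
    (ballSize_le_weight (lam j) (hx j) (hρ j))).ne'
  have := ballSize_pos (lam j) (hx j) (hρ j)
  exact ENNReal.ofReal_pos.2 (by positivity)

/-- Needs `lam j > -1 / 2`, since the box may contain boundary points of `(0, ∞)^n`. -/
theorem mu_box_lt_top {lam : Fin n → ℝ} (hlam : ∀ j, -1 / 2 < lam j) (x ρ : Fin n → ℝ) :
    mu lam (box x ρ) < ∞ := by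
  have := isLocallyFiniteMeasure_mu hlam
  exact isCompact_Icc.measure_lt_top

theorem exists_mu_box_doubling {lam : Fin n → ℝ} (hlam : ∀ j, -1 / 2 < lam j) :
    ∃ D : ℝ≥0, ∀ {x ρ : Fin n → ℝ}, (∀ j, 0 < x j) → (∀ j, 0 < ρ j) →
      mu lam (box x (3 • ρ)) ≤ D * mu lam (box x ρ) := by
  choose D hD using fun j => exists_weight_doubling (hlam j)
  refine ⟨∏ j, D j, fun {x ρ} hx hρ => ?_⟩
  rw [mu_box, mu_box, ENNReal.ofNNReal_finsetProd, ← Finset.prod_mul_distrib]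
  refine Finset.prod_le_prod' fun j _ => ?_
  simpa using hD j (hx j) (hρ j)

/-- Weak type `(1, 1)` estimate for averages over a family of boxes whose half side lengths `ρ t`
increase with `t` in all coordinates at once. Such a family satisfies the Vitali covering lemma with
the product of the half side lengths as size: if the size of one box is at most twice the size of
another one, the same is true of each of the half side lengths. -/
theorem mul_mu_setOf_lt_lintegral_box_le {lam : Fin n → ℝ} {D : ℝ≥0}
    (hD : ∀ {x ρ : Fin n → ℝ}, (∀ j, 0 < x j) → (∀ j, 0 < ρ j) →
      mu lam (box x (3 • ρ)) ≤ D * mu lam (box x ρ))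
    {T : Type*} [LinearOrder T] {ρ : T → Fin n → ℝ} (hmono : Monotone ρ) {S : Set T} {t₁ : T}
    (hS : ∀ t ∈ S, t ≤ t₁) (hρ : ∀ t ∈ S, ∀ j, 0 < ρ t j) (g : (Fin n → ℝ) → ℝ≥0∞) (c : ℝ≥0∞) :
    c * mu lam {x | (∀ j, 0 < x j) ∧ ∃ t ∈ S,
      c * mu lam (box x (ρ t)) < ∫⁻ y in box x (ρ t), g y ∂(mu lam)} ≤
      D * ∫⁻ y, g y ∂(mu lam) := by
  set I : Set ((Fin n → ℝ) × T) := {a | (∀ j, 0 < a.1 j) ∧ a.2 ∈ S ∧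
    c * mu lam (box a.1 (ρ a.2)) < ∫⁻ y in box a.1 (ρ a.2), g y ∂(mu lam)} with hI
  have hself : ∀ a ∈ I, a.1 ∈ box a.1 (ρ a.2) := fun a ha =>
    mem_box_iff.2 fun j => by simpa using (hρ a.2 ha.2.1 j).le
  obtain ⟨u, huI, hdisj, hcov⟩ := Vitali.exists_disjoint_subfamily_covering_enlargement
    (fun a : (Fin n → ℝ) × T => box a.1 (ρ a.2)) I (fun a => ∏ j, ρ a.2 j) 2 one_lt_two
    (fun a ha => Finset.prod_nonneg fun j _ => (hρ a.2 ha.2.1 j).le) (∏ j, ρ t₁ j)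
    (fun a ha => Finset.prod_le_prod (fun j _ => (hρ a.2 ha.2.1 j).le)
      fun j _ => hmono (hS _ ha.2.1) j) (fun a ha => ⟨_, hself a ha⟩)
  have hcount : u.Countable := by
    refine hdisj.countable_of_nonempty_interior fun a ha => ?_
    exact ⟨a.1, mem_interior_iff_mem_nhds.2 (box_mem_nhds _ (hρ _ (huI ha).2.1))⟩
  have hcmp : ∀ a ∈ I, ∀ b ∈ I, ∏ j, ρ a.2 j ≤ 2 * ∏ j, ρ b.2 j → ∀ j, ρ a.2 j ≤ 2 * ρ b.2 j := by
    intro a ha b hb hab i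
    have hapos := hρ a.2 ha.2.1
    have hbpos := hρ b.2 hb.2.1
    rcases le_total a.2 b.2 with h | h
    · linarith [hmono h i, hbpos i]
    · rw [← Finset.mul_prod_erase _ _ (Finset.mem_univ i),
        ← Finset.mul_prod_erase (a := i) _ _ (Finset.mem_univ i), ← mul_assoc] at hab
      have h1 : ∏ j ∈ Finset.univ.erase i, ρ b.2 j ≤ ∏ j ∈ Finset.univ.erase i, ρ a.2 j :=
        Finset.prod_le_prod (fun j _ => (hbpos j).le) fun j _ => hmono h j
      have h2 : 0 < ∏ j ∈ Finset.univ.erase i, ρ a.2 j := Finset.prod_pos fun j _ => hapos j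
      refine le_of_mul_le_mul_right (hab.trans ?_) h2
      have := (hbpos i).le
      gcongr
  have hsub : {x | (∀ j, 0 < x j) ∧ ∃ t ∈ S,
      c * mu lam (box x (ρ t)) < ∫⁻ y in box x (ρ t), g y ∂(mu lam)} ⊆
      ⋃ b ∈ u, box b.1 (3 • ρ b.2) := by
    rintro x ⟨hx, t, ht, hxt⟩
    have ha : (x, t) ∈ I := ⟨hx, ht, hxt⟩
    obtain ⟨b, hb, ⟨z, hz1, hz2⟩, hle⟩ := hcov _ ha
    -- the boxes meet, and the half side lengths of the first are at most twice those of the second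
    refine Set.mem_biUnion hb (mem_box_iff.2 fun j => ?_)
    have h1 := hcmp _ ha _ (huI hb) hle j
    have h2 := mem_box_iff.1 hz1 j
    have h3 := mem_box_iff.1 hz2 j
    simp only [Pi.smul_apply, nsmul_eq_mul, Nat.cast_ofNat]
    rw [abs_le] at *
    constructor <;> linarith [h2.1, h2.2, h3.1, h3.2]
  calc _ ≤ c * ∑' b : u, mu lam (box b.1.1 (3 • ρ b.1.2)) := by
        gcongr
        exact (measure_mono hsub).trans (measure_biUnion_le _ hcount _)
    _ ≤ ∑' b : u, D * ∫⁻ y in box b.1.1 (ρ b.1.2), g y ∂(mu lam) := by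
        rw [← ENNReal.tsum_mul_left]
        refine ENNReal.tsum_le_tsum fun b => ?_
        have hb := huI b.2
        calc _ ≤ c * (D * mu lam (box b.1.1 (ρ b.1.2))) := by
              gcongr; exact hD hb.1 (hρ _ hb.2.1)
          _ = D * (c * mu lam (box b.1.1 (ρ b.1.2))) := by ring
          _ ≤ _ := by gcongr; exact hb.2.2.le
    _ = D * ∫⁻ y in ⋃ b ∈ u, box b.1 (ρ b.2), g y ∂(mu lam) := by
        rw [ENNReal.tsum_mul_left,
          lintegral_biUnion hcount (fun _ _ => measurableSet_box _ _) hdisj]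
    _ ≤ _ := by gcongr; exact Measure.restrict_le_self

theorem aemeasurable_multiKernel {lam s x : Fin n → ℝ} (hlam : ∀ j, -1 / 2 < lam j)
    (hs : ∀ j, 0 < s j) (hx : ∀ j, 0 < x j) :
    AEMeasurable (multiKernel lam s x) (mu lam) :=
  Finset.aemeasurable_fun_prod _ fun j _ =>
    (aemeasurable_heatKernel (hlam j) (hs j) (hx j)).comp_quasiMeasurePreserving
      (Measure.quasiMeasurePreserving_eval (μ := fun j => weight (lam j)) j)

theorem multiKernel_nonneg {lam s x y : Fin n → ℝ} (hlam : ∀ j, -1 / 2 < lam j)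
    (hs : ∀ j, 0 < s j) (hx : ∀ j, 0 < x j) (hy : ∀ j, 0 < y j) : 0 ≤ multiKernel lam s x y :=
  Finset.prod_nonneg fun j _ => heatKernel_nonneg (hlam j) (hs j) (hx j) (hy j)

theorem lintegral_multiKernel {lam s x : Fin n → ℝ} (hlam : ∀ j, -1 / 2 < lam j)
    (hs : ∀ j, 0 < s j) (hx : ∀ j, 0 < x j) :
    ∫⁻ y, ENNReal.ofReal (multiKernel lam s x y) ∂(mu lam) = 1 := by
  have hnn : ∀ j, 0 ≤ᵐ[weight (lam j)] heatKernel (lam j) (s j) (x j) := fun j => by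
    filter_upwards [ae_weight_pos (lam j)] with y hy
    exact heatKernel_nonneg (hlam j) (hs j) (hx j) hy
  have h1 := fun j => lintegral_heatKernel (hlam j) (hs j) (hx j)
  have hi : ∀ j, Integrable (heatKernel (lam j) (s j) (x j)) (weight (lam j)) := fun j =>
    ⟨(aemeasurable_heatKernel (hlam j) (hs j) (hx j)).aestronglyMeasurable, by
      rw [hasFiniteIntegral_iff_ofReal (hnn j), h1 j]; exact ENNReal.one_lt_top⟩
  have hint : ∀ j, ∫ y, heatKernel (lam j) (s j) (x j) y ∂(weight (lam j)) = 1 := fun j => by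
    rw [integral_eq_lintegral_of_nonneg_ae (hnn j) (hi j).1, h1 j, ENNReal.toReal_one]
  rw [← ofReal_integral_eq_lintegral_ofReal]
  · unfold multiKernel mu
    rw [integral_fintype_prod_eq_prod (fun j => heatKernel (lam j) (s j) (x j))]
    simp [hint]
  · exact Integrable.fintype_prod_dep hi
  · filter_upwards [ae_mu_pos lam] with y hy
    exact multiKernel_nonneg hlam hs hx hy

theorem exists_pow_mul_exp_le (N : ℕ) : ∃ C : ℝ, 0 < C ∧ ∀ k : ℕ,
    ((k : ℝ) + 1) ^ N * Real.exp (-(3 * k)) ≤ C * (1 / 4) ^ k := by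
  refine ⟨N.factorial * Real.exp 1, by positivity, fun k => ?_⟩
  have h := Real.pow_div_factorial_le_exp ((k : ℝ) + 1) (by positivity) N
  rw [div_le_iff₀ (by positivity)] at h
  have he : Real.exp (-2) ≤ 1 / 4 := by
    rw [Real.exp_neg, show (2 : ℝ) = 1 + 1 by norm_num, Real.exp_add, one_div]
    have := Real.add_one_le_exp 1
    gcongr
    nlinarith
  calc _ ≤ Real.exp (k + 1) * N.factorial * Real.exp (-(3 * k)) := by gcongr
    _ = N.factorial * Real.exp 1 * Real.exp (-2) ^ k := by
      rw [← Real.exp_nat_mul, mul_right_comm, ← Real.exp_add, mul_assoc, ← Real.exp_add, mul_comm]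
      congr 2
      ring
    _ ≤ _ := by gcongr

/-- The half side lengths `(k + 1) √s` of the `k`-th box attached to the times `s`. -/
noncomputable def halfSides (s : Fin n → ℝ) (k : ℕ) : Fin n → ℝ := fun j => ((k : ℝ) + 1) * √(s j)

theorem halfSides_pos {s : Fin n → ℝ} (hs : ∀ j, 0 < s j) (k : ℕ) (j : Fin n) :
    0 < halfSides s k j := mul_pos (by positivity) (Real.sqrt_pos.2 (hs j))

/-- The kernel is dominated by an exponentially convergent sum of normalized indicators of the boxes
with half side lengths `(k + 1) √s`; the summand that matters is the one with `k` the integer part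
of the `ℓ¹` distance, measured on the scale `√s`. -/
theorem exists_multiKernel_le_tsum {lam : Fin n → ℝ} (hlam : ∀ j, -1 / 2 < lam j) :
    ∃ A : ℝ≥0, 0 < A ∧ ∀ {s x y : Fin n → ℝ}, (∀ j, 0 < s j) → (∀ j, 0 < x j) → (∀ j, 0 < y j) →
      ENNReal.ofReal (multiKernel lam s x y) ≤ ∑' k : ℕ, A * (1 / 4) ^ k *
        ((mu lam (box x (halfSides s k)))⁻¹ * (box x (halfSides s k)).indicator 1 y) := by
  choose C hC N hle using fun j => exists_heatKernel_mul_weight_le (hlam j)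
  obtain ⟨B, hB, hB'⟩ := exists_pow_mul_exp_le (∑ j, N j)
  have hCp : 0 < ∏ j, C j := Finset.prod_pos fun j _ => hC j
  refine ⟨Real.toNNReal ((∏ j, C j) * B), Real.toNNReal_pos.2 (by positivity),
    fun {s x y} hs hx hy => ?_⟩
  set m : ℝ := ∑ j, |x j - y j| / √(s j) with hm
  have hm0 : 0 ≤ m := by positivity
  set k := ⌊m⌋₊ with hk
  have hkm : (k : ℝ) ≤ m := Nat.floor_le hm0
  have hmk : m ≤ k + 1 := (Nat.lt_floor_add_one m).le
  have hmem : y ∈ box x (halfSides s k) := mem_box_iff.2 fun j => by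
    have h1 : |x j - y j| / √(s j) ≤ m :=
      Finset.single_le_sum (f := fun j => |x j - y j| / √(s j)) (fun j _ => by positivity)
        (Finset.mem_univ j)
    rw [halfSides, ← div_le_iff₀ (Real.sqrt_pos.2 (hs j))]
    exact h1.trans hmk
  refine le_trans ?_ (ENNReal.le_tsum k)
  rw [Set.indicator_of_mem hmem, Pi.one_apply, mul_one, ← div_eq_mul_inv,
    ENNReal.le_div_iff_mul_le (Or.inl (mu_box_pos lam hx (halfSides_pos hs k)))
      (Or.inl (mu_box_lt_top hlam _ _).ne), mu_box, multiKernel,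
    ENNReal.ofReal_prod_of_nonneg fun j _ => heatKernel_nonneg (hlam j) (hs j) (hx j) (hy j),
    ← Finset.prod_mul_distrib]
  have hk1 : (1 : ℝ) ≤ (k : ℝ) + 1 := by linarith [(Nat.cast_nonneg k : (0 : ℝ) ≤ k)]
  calc _ ≤ ∏ j, ENNReal.ofReal (C j * ((k : ℝ) + 1) ^ N j *
          Real.exp (-(3 * (|x j - y j| / √(s j))))) :=
        Finset.prod_le_prod' fun j _ => hle j (hs j) (hx j) (hy j) hk1
    _ = ENNReal.ofReal ((∏ j, C j) * (((k : ℝ) + 1) ^ (∑ j, N j) * Real.exp (-(3 * m)))) := by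
        rw [← ENNReal.ofReal_prod_of_nonneg fun j _ => by have := hC j; positivity,
          Finset.prod_mul_distrib, Finset.prod_mul_distrib, Finset.prod_pow_eq_pow_sum,
          ← Real.exp_sum, Finset.sum_neg_distrib, ← Finset.mul_sum, mul_assoc]
    _ ≤ ENNReal.ofReal ((∏ j, C j) * (B * (1 / 4) ^ k)) := by
        refine ENNReal.ofReal_le_ofReal (mul_le_mul_of_nonneg_left (le_trans ?_ (hB' k)) hCp.le)
        gcongr
    _ = _ := by
        rw [← mul_assoc, ENNReal.ofReal_mul (by positivity), ENNReal.ofReal_pow (by positivity),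
          ENNReal.ofReal_div_of_pos (by norm_num)]
        simp
        rfl

/-! ### The maximal operator, and convergence for continuous functions -/

/-- The operator with kernel `multiKernel` is dominated by an exponentially convergent sum of averages
over boxes. -/
theorem exists_lintegral_multiKernel_mul_le {lam : Fin n → ℝ} (hlam : ∀ j, -1 / 2 < lam j) :
    ∃ A : ℝ≥0, 0 < A ∧ ∀ {s x : Fin n → ℝ} {g : (Fin n → ℝ) → ℝ≥0∞}, (∀ j, 0 < s j) →
      (∀ j, 0 < x j) → AEMeasurable g (mu lam) →
      ∫⁻ y, ENNReal.ofReal (multiKernel lam s x y) * g y ∂(mu lam) ≤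
        ∑' k : ℕ, A * (1 / 4) ^ k * ((mu lam (box x (halfSides s k)))⁻¹ *
          ∫⁻ y in box x (halfSides s k), g y ∂(mu lam)) := by
  obtain ⟨A, hA, hle⟩ := exists_multiKernel_le_tsum hlam
  refine ⟨A, hA, fun {s x g} hs hx hg => ?_⟩
  have hmeas : ∀ k, AEMeasurable ((box x (halfSides s k)).indicator g) (mu lam) := fun k =>
    hg.indicator (measurableSet_box _ _)
  calc _ ≤ ∫⁻ y, ∑' k : ℕ, A * (1 / 4) ^ k * ((mu lam (box x (halfSides s k)))⁻¹ *
          (box x (halfSides s k)).indicator g y) ∂(mu lam) := by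
        refine lintegral_mono_ae ?_
        filter_upwards [ae_mu_pos lam] with y hy
        refine (mul_le_mul_left (hle hs hx hy) (g y)).trans_eq ?_
        rw [← ENNReal.tsum_mul_right]
        refine tsum_congr fun k => ?_
        by_cases h : y ∈ box x (halfSides s k) <;> simp [h, mul_assoc]
    _ = _ := by
        rw [lintegral_tsum fun k => ((hmeas k).const_mul _).const_mul _]
        refine tsum_congr fun k => ?_
        rw [lintegral_const_mul'' _ ((hmeas k).const_mul _), lintegral_const_mul'' _ (hmeas k),
          lintegral_indicator (measurableSet_box _ _)]

theorem tsum_inv_two_pow_succ : ∑' k : ℕ, (2⁻¹ : ℝ≥0∞) ^ (k + 1) = 1 := by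
  rw [ENNReal.tsum_geometric_add_one, ENNReal.one_sub_inv_two, inv_inv,
    ENNReal.inv_mul_cancel two_ne_zero ENNReal.ofNat_ne_top]

/-- Weak type `(1, 1)` estimate for the maximal operator of the heat kernel along the curve `r`. -/
theorem exists_mul_mu_setOf_lt_lintegral_multiKernel_le {lam : Fin n → ℝ}
    (hlam : ∀ j, -1 / 2 < lam j) {r : Fin n → ℝ≥0 → ℝ≥0} (hr_mono : ∀ j, Monotone (r j))
    (hr_pos : ∀ j t, 0 < t → 0 < r j t) :
    ∃ A : ℝ≥0, ∀ (g : (Fin n → ℝ) → ℝ≥0∞), AEMeasurable g (mu lam) → ∀ c : ℝ≥0∞,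
      c * mu lam {x | (∀ j, 0 < x j) ∧ ∃ t ∈ Set.Ioc (0 : ℝ≥0) 1,
        c < ∫⁻ y, ENNReal.ofReal (multiKernel lam (fun j => (r j t : ℝ)) x y) * g y ∂(mu lam)} ≤
      A * ∫⁻ y, g y ∂(mu lam) := by
  obtain ⟨A, hA, hle⟩ := exists_lintegral_multiKernel_mul_le hlam
  obtain ⟨D, hD⟩ := exists_mu_box_doubling hlam
  refine ⟨4 * A * D, fun g hg c => ?_⟩
  have hA0 : (A : ℝ≥0∞) ≠ 0 := by exact_mod_cast hA.ne'
  have hA1 : (A : ℝ≥0∞) ≠ ∞ := ENNReal.coe_ne_top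
  set ρ : ℕ → ℝ≥0 → Fin n → ℝ := fun k t => halfSides (fun j => (r j t : ℝ)) k with hρ
  have hρm : ∀ k, Monotone (ρ k) := fun k t t' h j => by
    have := hr_mono j h
    simp only [hρ, halfSides]
    gcongr
  have hρp : ∀ k, ∀ t ∈ Set.Ioc (0 : ℝ≥0) 1, ∀ j, 0 < ρ k t j := fun k t ht j =>
    halfSides_pos (fun j => by exact_mod_cast hr_pos j t ht.1) k j
  -- the threshold for the averages over the `k`-th boxes: `4⁻ᵏ A` times it is `2⁻⁽ᵏ⁺¹⁾ c`
  set d : ℕ → ℝ≥0∞ := fun k => c * (2⁻¹ * 2 ^ k * (A : ℝ≥0∞)⁻¹) with hd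
  set E : ℕ → Set (Fin n → ℝ) := fun k => {x | (∀ j, 0 < x j) ∧ ∃ t ∈ Set.Ioc (0 : ℝ≥0) 1,
      d k * mu lam (box x (ρ k t)) < ∫⁻ y in box x (ρ k t), g y ∂(mu lam)} with hE
  have hEk : ∀ k, d k * mu lam (E k) ≤ D * ∫⁻ y, g y ∂(mu lam) := fun k =>
    mul_mu_setOf_lt_lintegral_box_le hD (hρm k) (fun t ht => ht.2) (hρp k) g (d k)
  have hpow : ∀ k : ℕ, (2 : ℝ≥0∞) ^ k * 2⁻¹ ^ k = 1 := fun k => by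
    rw [← mul_pow, ENNReal.mul_inv_cancel two_ne_zero ENNReal.ofNat_ne_top, one_pow]
  have hsub : {x | (∀ j, 0 < x j) ∧ ∃ t ∈ Set.Ioc (0 : ℝ≥0) 1,
      c < ∫⁻ y, ENNReal.ofReal (multiKernel lam (fun j => (r j t : ℝ)) x y) * g y ∂(mu lam)} ⊆
      ⋃ k, E k := by
    rintro x ⟨hx, t, ht, hct⟩
    by_contra hcon
    simp only [hE, Set.mem_iUnion, Set.mem_ofPred_eq, not_exists, not_and, not_lt] at hcon
    refine hct.not_ge ?_
    have hs : ∀ j, (0 : ℝ) < r j t := fun j => by exact_mod_cast hr_pos j t ht.1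
    calc _ ≤ ∑' k : ℕ, A * (1 / 4) ^ k * ((mu lam (box x (ρ k t)))⁻¹ *
          ∫⁻ y in box x (ρ k t), g y ∂(mu lam)) := hle hs hx hg
      _ ≤ ∑' k : ℕ, A * (1 / 4) ^ k * d k := by
          refine ENNReal.tsum_le_tsum fun k => ?_
          gcongr
          rw [mul_comm, ← div_eq_mul_inv]
          exact ENNReal.div_le_of_le_mul (hcon k hx t ht)
      _ = ∑' k : ℕ, c * 2⁻¹ ^ (k + 1) := by
          refine tsum_congr fun k => ?_
          have h4 : (1 / 4 : ℝ≥0∞) = 2⁻¹ * 2⁻¹ := by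
            rw [one_div, ← ENNReal.mul_inv (by simp) (by simp)]; norm_num
          calc _ = c * (2 ^ k * 2⁻¹ ^ k) * (A * (A : ℝ≥0∞)⁻¹) * (2⁻¹ ^ k * 2⁻¹) := by
                rw [h4, mul_pow]; simp only [hd]; ring
            _ = _ := by rw [hpow, ENNReal.mul_inv_cancel hA0 hA1, mul_one, mul_one, pow_succ]
      _ = c := by rw [ENNReal.tsum_mul_left, tsum_inv_two_pow_succ, mul_one]
  calc _ ≤ c * ∑' k, mu lam (E k) := by
        gcongr
        exact (measure_mono hsub).trans (measure_iUnion_le _)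
    _ = ∑' k : ℕ, 4 * A * 2⁻¹ ^ (k + 1) * (d k * mu lam (E k)) := by
        rw [← ENNReal.tsum_mul_left]
        refine tsum_congr fun k => ?_
        have h4 : (4 : ℝ≥0∞) * 2⁻¹ * 2⁻¹ = 1 := by
          rw [show (4 : ℝ≥0∞) = 2 * 2 by norm_num, mul_assoc 2 2,
            ENNReal.mul_inv_cancel two_ne_zero ENNReal.ofNat_ne_top, mul_one,
            ENNReal.mul_inv_cancel two_ne_zero ENNReal.ofNat_ne_top]
        symm
        calc _ = (4 * 2⁻¹ * 2⁻¹) * (2 ^ k * 2⁻¹ ^ k) * (A * (A : ℝ≥0∞)⁻¹) *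
              (c * mu lam (E k)) := by simp only [hd]; ring
          _ = _ := by rw [hpow, ENNReal.mul_inv_cancel hA0 hA1, h4, mul_one, mul_one, one_mul]
    _ ≤ ∑' k : ℕ, 4 * A * 2⁻¹ ^ (k + 1) * (D * ∫⁻ y, g y ∂(mu lam)) := by
        exact ENNReal.tsum_le_tsum fun k => mul_le_mul_right (hEk k) _
    _ = _ := by
        rw [ENNReal.tsum_mul_right, ENNReal.tsum_mul_left, tsum_inv_two_pow_succ]
        push_cast
        ring

/-- Dominated convergence for the sum over boxes: the averages of `G` over each of the shrinking boxes
tend to `0`. -/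
theorem tendsto_lintegral_multiKernel_mul {lam : Fin n → ℝ}
    (hlam : ∀ j, -1 / 2 < lam j) {r : Fin n → ℝ≥0 → ℝ≥0} (hr_cont : ∀ j, Continuous (r j))
    (hr_zero : ∀ j, r j 0 = 0) (hr_pos : ∀ j t, 0 < t → 0 < r j t)
    {G : (Fin n → ℝ) → ℝ≥0∞} (hG : Measurable G) {M : ℝ≥0∞} (hM : M ≠ ∞) (hGM : ∀ y, G y ≤ M)
    {x : Fin n → ℝ} (hx : ∀ j, 0 < x j) (hGx : Tendsto G (𝓝 x) (𝓝 0)) :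
    Tendsto (fun t : ℝ≥0 =>
      ∫⁻ y, ENNReal.ofReal (multiKernel lam (fun j => (r j t : ℝ)) x y) * G y ∂(mu lam))
      (𝓝[>] 0) (𝓝 0) := by
  obtain ⟨A, hA, hle⟩ := exists_lintegral_multiKernel_mul_le hlam
  set ρ : ℕ → ℝ≥0 → Fin n → ℝ := fun k t => halfSides (fun j => (r j t : ℝ)) k with hρ
  have hpos : ∀ t : ℝ≥0, 0 < t → ∀ j, (0 : ℝ) < r j t := fun t ht j => by
    exact_mod_cast hr_pos j t ht
  have havg : ∀ {k : ℕ} {t : ℝ≥0} {a : ℝ≥0∞}, 0 < t → (∀ y ∈ box x (ρ k t), G y ≤ a) →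
      (mu lam (box x (ρ k t)))⁻¹ * ∫⁻ y in box x (ρ k t), G y ∂(mu lam) ≤ a := by
    intro k t a ht h
    rw [mul_comm, ← div_eq_mul_inv]
    refine ENNReal.div_le_of_le_mul ?_
    rw [← setLIntegral_const]
    exact setLIntegral_mono' (measurableSet_box _ _) h
  set F : ℝ≥0 → ℕ → ℝ≥0∞ := fun t k => A * (1 / 4) ^ k * ((mu lam (box x (ρ k t)))⁻¹ *
    ∫⁻ y in box x (ρ k t), G y ∂(mu lam)) with hF
  have hlim : Tendsto (fun t => ∑' k, F t k) (𝓝[>] 0) (𝓝 0) := by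
    simp only [← lintegral_count]
    rw [← lintegral_zero (μ := (Measure.count : Measure ℕ))]
    refine tendsto_lintegral_filter_of_dominated_convergence
      (fun k : ℕ => A * (1 / 4) ^ k * M) (Eventually.of_forall fun t => measurable_of_countable _)
      ?_ ?_ (ae_of_all _ fun k => ?_)
    · filter_upwards [self_mem_nhdsWithin] with t ht
      exact ae_of_all _ fun k => mul_le_mul_right (havg ht fun y _ => hGM y) _
    · rw [lintegral_count, ENNReal.tsum_mul_right, ENNReal.tsum_mul_left, ENNReal.tsum_geometric]
      refine ENNReal.mul_ne_top (ENNReal.mul_ne_top ENNReal.coe_ne_top ?_) hM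
      refine ENNReal.inv_ne_top.2 (tsub_pos_of_lt ?_).ne'
      rw [one_div]
      exact ENNReal.inv_lt_one.2 (by norm_num)
    · have h1 : Tendsto (ρ k) (𝓝 0) (𝓝 0) := by
        have hc : Continuous (ρ k) := by
          simp only [hρ]; unfold halfSides; fun_prop
        have := hc.tendsto 0
        rwa [show ρ k 0 = 0 by ext j; simp [hρ, halfSides, hr_zero]] at this
      have h2 : Tendsto (fun t => box x (ρ k t)) (𝓝 0) (𝓝 x).smallSets :=
        Tendsto.Icc (by simpa using h1.const_sub x) (by simpa using h1.const_add x)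
      have h3 : Tendsto (fun t => (mu lam (box x (ρ k t)))⁻¹ *
          ∫⁻ y in box x (ρ k t), G y ∂(mu lam)) (𝓝[>] 0) (𝓝 0) := by
        refine ENNReal.tendsto_nhds_zero.2 fun ε hε => ?_
        have h4 := (h2.mono_left (nhdsWithin_le_nhds (s := Set.Ioi 0))).eventually
          (eventually_smallSets_forall.2 (ENNReal.tendsto_nhds_zero.1 hGx ε hε))
        filter_upwards [self_mem_nhdsWithin, h4] with t ht h5
        exact havg ht h5
      have h6 := ENNReal.Tendsto.const_mul (a := (A : ℝ≥0∞) * (1 / 4) ^ k) h3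
        (Or.inr (ENNReal.mul_ne_top ENNReal.coe_ne_top (ENNReal.pow_ne_top (by simp))))
      rwa [mul_zero] at h6
  refine tendsto_of_tendsto_of_tendsto_of_le_of_le' tendsto_const_nhds hlim
    (Eventually.of_forall fun _ => zero_le) ?_
  filter_upwards [self_mem_nhdsWithin] with t ht
  exact hle (hpos t ht) hx hG.aemeasurable

/-! ### Convergence almost everywhere -/

/-- The probability measure with density `multiKernel lam s x` with respect to `mu lam`. -/
noncomputable def heatMeasure (lam s x : Fin n → ℝ) : Measure (Fin n → ℝ) :=
  (mu lam).withDensity fun y => ENNReal.ofReal (multiKernel lam s x y)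

section
variable {lam s x : Fin n → ℝ} (hlam : ∀ j, -1 / 2 < lam j) (hs : ∀ j, 0 < s j)
  (hx : ∀ j, 0 < x j)
include hlam hs hx

theorem isProbabilityMeasure_heatMeasure : IsProbabilityMeasure (heatMeasure lam s x) :=
  ⟨by rw [heatMeasure, withDensity_apply _ MeasurableSet.univ, Measure.restrict_univ,
    lintegral_multiKernel hlam hs hx]⟩

theorem lintegral_heatMeasure (g : (Fin n → ℝ) → ℝ≥0∞) :
    ∫⁻ y, g y ∂(heatMeasure lam s x) =
      ∫⁻ y, ENNReal.ofReal (multiKernel lam s x y) * g y ∂(mu lam) :=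
  lintegral_withDensity_eq_lintegral_mul_non_measurable₀ _
    (aemeasurable_multiKernel hlam hs hx).ennreal_ofReal
    (ae_of_all _ fun _ => ENNReal.ofReal_lt_top) _

/-- The kernel is bounded as a function of its second variable, so that `L^p` functions for `mu lam`
are `L^p` functions for `heatMeasure lam s x`. -/
theorem exists_heatMeasure_le_smul : ∃ c : ℝ≥0∞, c ≠ ∞ ∧ heatMeasure lam s x ≤ c • mu lam := by
  obtain ⟨A, -, hle⟩ := exists_multiKernel_le_tsum hlam
  refine ⟨∑' k : ℕ, A * (1 / 4) ^ k * (mu lam (box x (halfSides s 0)))⁻¹, ?_, ?_⟩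
  · rw [ENNReal.tsum_mul_right, ENNReal.tsum_mul_left, ENNReal.tsum_geometric]
    refine ENNReal.mul_ne_top (ENNReal.mul_ne_top ENNReal.coe_ne_top ?_)
      (ENNReal.inv_ne_top.2 (mu_box_pos lam hx (halfSides_pos hs 0)))
    refine ENNReal.inv_ne_top.2 (tsub_pos_of_lt ?_).ne'
    rw [one_div]
    exact ENNReal.inv_lt_one.2 (by norm_num)
  · rw [← withDensity_const]
    refine withDensity_mono ?_
    filter_upwards [ae_mu_pos lam] with y hy
    refine (hle hs hx hy).trans (ENNReal.tsum_le_tsum fun k => ?_)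
    refine mul_le_mul_right ?_ _
    have hsub : box x (halfSides s 0) ⊆ box x (halfSides s k) := fun z hz =>
      mem_box_iff.2 fun j => (mem_box_iff.1 hz j).trans (by
        simp only [halfSides]; gcongr; exact Nat.cast_nonneg k)
    calc _ ≤ (mu lam (box x (halfSides s k)))⁻¹ * 1 := by
          gcongr; exact Set.indicator_le_self' (fun _ _ => zero_le) y
      _ ≤ _ := by rw [mul_one]; exact ENNReal.inv_le_inv.2 (measure_mono hsub)

variable {𝕜 : Type*} [RCLike 𝕜] {f : (Fin n → ℝ) → 𝕜}

theorem ae_toReal_ofReal_multiKernel_smul (f : (Fin n → ℝ) → 𝕜) :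
    (fun y => (ENNReal.ofReal (multiKernel lam s x y)).toReal • f y) =ᵐ[mu lam]
      fun y => multiKernel lam s x y • f y := by
  filter_upwards [ae_mu_pos lam] with y hy
  rw [ENNReal.toReal_ofReal (multiKernel_nonneg hlam hs hx hy)]

theorem heatOp_eq_integral_heatMeasure (f : (Fin n → ℝ) → 𝕜) :
    heatOp lam s f x = ∫ y, f y ∂(heatMeasure lam s x) := by
  rw [heatOp, heatMeasure, integral_withDensity_eq_integral_toReal_smul₀
    (aemeasurable_multiKernel hlam hs hx).ennreal_ofReal
    (ae_of_all _ fun _ => ENNReal.ofReal_lt_top)]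
  exact integral_congr_ae (ae_toReal_ofReal_multiKernel_smul hlam hs hx f).symm

theorem memLp_heatMeasure {p : ℝ≥0∞} (hf : MemLp f p (mu lam)) :
    MemLp f p (heatMeasure lam s x) := by
  obtain ⟨c, hc, hle⟩ := exists_heatMeasure_le_smul hlam hs hx
  exact hf.of_measure_le_smul hc hle

theorem integrable_multiKernel_smul {p : ℝ≥0∞} (hp : 1 ≤ p) (hf : MemLp f p (mu lam)) :
    Integrable (fun y => multiKernel lam s x y • f y) (mu lam) := by
  have := isProbabilityMeasure_heatMeasure hlam hs hx
  have h := (memLp_heatMeasure hlam hs hx hf).integrable hp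
  rw [heatMeasure, integrable_withDensity_iff_integrable_smul₀'
    (aemeasurable_multiKernel hlam hs hx).ennreal_ofReal
    (ae_of_all _ fun _ => ENNReal.ofReal_lt_top)] at h
  exact h.congr (ae_toReal_ofReal_multiKernel_smul hlam hs hx f)

/-- Jensen's inequality for the probability measure `heatMeasure lam s x`, combined with the
triangle inequality in its `L^p` space. -/
theorem enorm_heatOp_sub_le {p : ℝ≥0∞} (hp : 1 ≤ p) (hf : MemLp f p (mu lam))
    {g : (Fin n → ℝ) → 𝕜} (hg : MemLp g p (mu lam)) :
    ‖heatOp lam s f x - f x‖ₑ ≤ eLpNorm (f - g) p (heatMeasure lam s x) +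
      eLpNorm (fun y => g y - g x) p (heatMeasure lam s x) + ‖(f - g) x‖ₑ := by
  have := isProbabilityMeasure_heatMeasure hlam hs hx
  have hf' := memLp_heatMeasure hlam hs hx hf
  have hg' := memLp_heatMeasure hlam hs hx hg
  have h1 : heatOp lam s f x - f x = ∫ y, (f y - f x) ∂(heatMeasure lam s x) := by
    rw [integral_sub (hf'.integrable hp) (integrable_const _), integral_const,
      heatOp_eq_integral_heatMeasure hlam hs hx]
    simp
  have h2 : (fun y => f y - f x) = (f - g) + (fun y => g y - g x) + fun _ => g x - f x := by
    ext y; simp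
  have hfg := hf'.1.sub hg'.1
  have hgc : AEStronglyMeasurable (fun y => g y - g x) (heatMeasure lam s x) :=
    hg'.1.sub aestronglyMeasurable_const
  have hc : AEStronglyMeasurable (fun _ : Fin n → ℝ => g x - f x) (heatMeasure lam s x) :=
    aestronglyMeasurable_const
  calc _ ≤ ∫⁻ y, ‖f y - f x‖ₑ ∂(heatMeasure lam s x) := by
        rw [h1]; exact enorm_integral_le_lintegral_enorm _
    _ = eLpNorm (fun y => f y - f x) 1 (heatMeasure lam s x) :=
        eLpNorm_one_eq_lintegral_enorm.symm
    _ ≤ eLpNorm (fun y => f y - f x) p (heatMeasure lam s x) :=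
        eLpNorm_le_eLpNorm_of_exponent_le hp (hf'.1.sub aestronglyMeasurable_const)
    _ ≤ eLpNorm (f - g) p (heatMeasure lam s x) +
        eLpNorm (fun y => g y - g x) p (heatMeasure lam s x) +
        eLpNorm (fun _ => g x - f x) p (heatMeasure lam s x) := by
        rw [h2]
        refine (eLpNorm_add_le (hfg.add hgc) hc hp).trans ?_
        gcongr
        exact eLpNorm_add_le hfg hgc hp
    _ = _ := by
        rw [eLpNorm_const _ (zero_lt_one.trans_le hp).ne' (IsProbabilityMeasure.ne_zero _)]
        simp [← enorm_neg (g x - f x)]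

end

theorem tendsto_eLpNorm_sub_heatMeasure {lam : Fin n → ℝ}
    (hlam : ∀ j, -1 / 2 < lam j) {r : Fin n → ℝ≥0 → ℝ≥0} (hr_cont : ∀ j, Continuous (r j))
    (hr_zero : ∀ j, r j 0 = 0) (hr_pos : ∀ j t, 0 < t → 0 < r j t)
    {p : ℝ≥0∞} (hp : 1 ≤ p) (hp_top : p ≠ ∞) {𝕜 : Type*} [RCLike 𝕜] {g : (Fin n → ℝ) → 𝕜}
    (hg : Continuous g) (hgs : HasCompactSupport g) {x : Fin n → ℝ} (hx : ∀ j, 0 < x j) :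
    Tendsto (fun t : ℝ≥0 =>
      eLpNorm (fun y => g y - g x) p (heatMeasure lam (fun j => (r j t : ℝ)) x))
      (𝓝[>] 0) (𝓝 0) := by
  have hp0 : p ≠ 0 := (zero_lt_one.trans_le hp).ne'
  have hq : 0 < p.toReal := ENNReal.toReal_pos hp0 hp_top
  obtain ⟨C, hC⟩ := hgs.exists_bound_of_continuous hg
  have hG : Continuous fun y => ‖g y - g x‖ₑ ^ p.toReal :=
    ENNReal.continuous_rpow_const.comp (hg.sub continuous_const).enorm
  have hbound : ∀ y, ‖g y - g x‖ₑ ^ p.toReal ≤ ENNReal.ofReal (C + C) ^ p.toReal := fun y => by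
    gcongr
    rw [← ofReal_norm]
    exact ENNReal.ofReal_le_ofReal ((norm_sub_le _ _).trans (add_le_add (hC y) (hC x)))
  have hlim := tendsto_lintegral_multiKernel_mul hlam hr_cont hr_zero hr_pos hG.measurable
    (ENNReal.rpow_ne_top_of_nonneg hq.le ENNReal.ofReal_ne_top) hbound hx (by
      simpa [hq] using hG.tendsto x)
  have hlim' := (ENNReal.continuous_rpow_const (y := 1 / p.toReal)).tendsto 0 |>.comp hlim
  rw [ENNReal.zero_rpow_of_pos (by positivity)] at hlim'
  refine hlim'.congr' ?_
  filter_upwards [self_mem_nhdsWithin] with t ht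
  rw [eLpNorm_eq_lintegral_rpow_enorm_toReal hp0 hp_top,
    lintegral_heatMeasure hlam (fun j => by exact_mod_cast hr_pos j t ht) hx]
  rfl

/-- For continuous compactly supported `g` close to `f` in `L^p`, the weak type estimate for
`|f - g| ^ p` and Chebyshev's inequality bound the measure of the exceptional set by a multiple of
the `p`-th power of the `L^p` distance of `f` and `g`. -/
theorem mu_setOf_not_eventually_enorm_le {lam : Fin n → ℝ}
    (hlam : ∀ j, -1 / 2 < lam j) {r : Fin n → ℝ≥0 → ℝ≥0} (hr_cont : ∀ j, Continuous (r j))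
    (hr_mono : ∀ j, Monotone (r j))
    (hr_zero : ∀ j, r j 0 = 0) (hr_pos : ∀ j t, 0 < t → 0 < r j t)
    {p : ℝ≥0∞} (hp : 1 ≤ p) (hp_top : p ≠ ∞) {𝕜 : Type*} [RCLike 𝕜] {f : (Fin n → ℝ) → 𝕜}
    (hf : MemLp f p (mu lam)) {ε : ℝ≥0∞} (hε : ε ≠ 0) :
    mu lam {x | (∀ j, 0 < x j) ∧ ¬ ∀ᶠ t : ℝ≥0 in 𝓝[>] 0,
      ‖heatOp lam (fun j => (r j t : ℝ)) f x - f x‖ₑ ≤ ε} = 0 := by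
  have := isLocallyFiniteMeasure_mu hlam
  have hp0 : p ≠ 0 := (zero_lt_one.trans_le hp).ne'
  have hq : 0 < p.toReal := ENNReal.toReal_pos hp0 hp_top
  have hε3 : ε / 3 ≠ 0 := (ENNReal.div_pos hε (by norm_num)).ne'
  obtain ⟨A, hA⟩ := exists_mul_mu_setOf_lt_lintegral_multiKernel_le hlam hr_mono hr_pos
  set X := {x | (∀ j, 0 < x j) ∧ ¬ ∀ᶠ t : ℝ≥0 in 𝓝[>] 0,
      ‖heatOp lam (fun j => (r j t : ℝ)) f x - f x‖ₑ ≤ ε} with hX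
  set c := (ε / 3) ^ p.toReal with hc
  have hc0 : c ≠ 0 := (ENNReal.rpow_pos_of_nonneg (pos_iff_ne_zero.2 hε3) hq.le).ne'
  have key : ∀ δ : ℝ≥0, 0 < δ → c * mu lam X ≤ (A + 1) * δ := by
    intro δ hδ
    obtain ⟨g, hgs, hfg, hgc, hg⟩ := hf.exists_hasCompactSupport_eLpNorm_sub_le hp_top
      (ε := (δ : ℝ≥0∞) ^ (1 / p.toReal))
      (ENNReal.rpow_pos (by exact_mod_cast hδ) ENNReal.coe_ne_top).ne'
    set G : (Fin n → ℝ) → ℝ≥0∞ := fun y => ‖(f - g) y‖ₑ ^ p.toReal with hGdef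
    have hGm : AEMeasurable G (mu lam) := (hf.1.sub hg.1).enorm.pow_const _
    have hGδ : ∫⁻ y, G y ∂(mu lam) ≤ δ := by
      rw [eLpNorm_eq_lintegral_rpow_enorm_toReal hp0 hp_top] at hfg
      exact (ENNReal.rpow_le_rpow_iff (by positivity)).1 hfg
    have hsub : X ⊆ {x | (∀ j, 0 < x j) ∧ ∃ t ∈ Set.Ioc (0 : ℝ≥0) 1,
        c < ∫⁻ y, ENNReal.ofReal (multiKernel lam (fun j => (r j t : ℝ)) x y) * G y ∂(mu lam)} ∪
        {x | c ≤ G x} := by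
      rintro x ⟨hx, hxe⟩
      by_contra hcon
      simp only [Set.mem_union, Set.mem_ofPred_eq, not_or, not_and, not_exists, not_lt, not_le]
        at hcon
      refine hxe ?_
      have h3 := ENNReal.tendsto_nhds_zero.1 (tendsto_eLpNorm_sub_heatMeasure hlam hr_cont hr_zero
        hr_pos hp hp_top hgc hgs hx) (ε / 3) (pos_iff_ne_zero.2 hε3)
      filter_upwards [h3, Ioc_mem_nhdsGT zero_lt_one] with t h3 ht
      have hs : ∀ j, (0 : ℝ) < r j t := fun j => by exact_mod_cast hr_pos j t ht.1
      refine (enorm_heatOp_sub_le hlam hs hx hp hf hg).trans ?_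
      rw [← ENNReal.add_thirds ε]
      refine add_le_add (add_le_add ?_ h3) ?_
      · rw [eLpNorm_eq_lintegral_rpow_enorm_toReal hp0 hp_top, lintegral_heatMeasure hlam hs hx,
          one_div, ENNReal.rpow_inv_le_iff hq]
        exact hcon.1 hx t ht
      · exact ((ENNReal.rpow_lt_rpow_iff hq).1 hcon.2).le
    calc c * mu lam X ≤ c * (mu lam _ + mu lam _) := by
          gcongr
          exact (measure_mono hsub).trans (measure_union_le _ _)
      _ ≤ A * ∫⁻ y, G y ∂(mu lam) + ∫⁻ y, G y ∂(mu lam) := by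
          rw [mul_add]
          exact add_le_add (hA G hGm c) (mul_meas_ge_le_lintegral₀ hGm c)
      _ ≤ A * δ + δ := by gcongr
      _ = _ := by ring
  have hzero : c * mu lam X = 0 := by
    refine le_antisymm (ENNReal.le_of_forall_pos_le_add fun η hη _ => ?_) zero_le
    refine (key (η / (A + 1)) (by positivity)).trans_eq ?_
    rw [zero_add]
    norm_cast
    field_simp
  exact (mul_eq_zero.1 hzero).resolve_left hc0

end BesselHeat

theorem corollary1p2 {n : ℕ} {𝕜 : Type*} [RCLike 𝕜] (lam : Fin n → ℝ)
    (hlam : ∀ j, -1 / 2 < lam j)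
    (r : Fin n → ℝ≥0 → ℝ≥0) (hr_cont : ∀ j, Continuous (r j)) (hr_mono : ∀ j, Monotone (r j))
    (hr_zero : ∀ j, r j 0 = 0) (hr_pos : ∀ j t, 0 < t → 0 < r j t)
    (hr_top : ∀ j, Tendsto (r j) atTop atTop)
    (p : ℝ≥0∞) (hp : 1 ≤ p) (hp_top : p ≠ ∞)
    (f : (Fin n → ℝ) → 𝕜) (hf : MemLp f p (BesselHeat.mu lam)) :
    (∀ t : ℝ≥0, 0 < t → ∀ x : Fin n → ℝ, (∀ j, 0 < x j) →
      Integrable (fun y => BesselHeat.multiKernel lam (fun j => (r j t : ℝ)) x y • f y)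
        (BesselHeat.mu lam)) ∧
    ∀ᵐ x ∂(BesselHeat.mu lam),
      Tendsto (fun t : ℝ≥0 => BesselHeat.heatOp lam (fun j => (r j t : ℝ)) f x)
        (𝓝[>] 0) (𝓝 (f x)) := by
  refine ⟨fun t ht x hx => BesselHeat.integrable_multiKernel_smul hlam
    (fun j => by exact_mod_cast hr_pos j t ht) hx hp hf, ?_⟩
  have hex : ∀ m : ℕ, ∀ᵐ x ∂(BesselHeat.mu lam), ¬ ((∀ j, 0 < x j) ∧ ¬ ∀ᶠ t : ℝ≥0 in 𝓝[>] 0,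
      ‖BesselHeat.heatOp lam (fun j => (r j t : ℝ)) f x - f x‖ₑ ≤ (m : ℝ≥0∞)⁻¹) := fun m =>
    measure_eq_zero_iff_ae_notMem.1 (BesselHeat.mu_setOf_not_eventually_enorm_le hlam hr_cont
      hr_mono hr_zero hr_pos hp hp_top hf (ENNReal.inv_ne_zero.2 (ENNReal.natCast_ne_top m)))
  filter_upwards [BesselHeat.ae_mu_pos lam, ae_all_iff.2 hex] with x hx hxe
  refine tendsto_iff_edist_tendsto_0.2 (ENNReal.tendsto_nhds_zero.2 fun ε hε => ?_)
  obtain ⟨m, hm⟩ := ENNReal.exists_inv_nat_lt hε.ne'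
  filter_upwards [not_not.1 (not_and.1 (hxe m) hx)] with t ht
  rw [edist_eq_enorm_sub]
  exact ht.trans hm.le
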